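/- Let $\mathbf k$ be a commutative ring with unit, $m\ge 0$, and let $\mathcal K$ be a simplicial complex on the vertex set $[m]=\{1,\dots,m\}$ (so all singletons are simplices). **The permutohedral complex.** For an ordered partition $(U_1|\cdots|U_n)$ of $[m]$ into nonempty parts let $F(U_1|\cdots|U_n)\subset\mathbb R^m$ be the corresponding face of the permutohedron $\operatorname{conv}\{(\sigma(1),\dots,\sigma(m)):\sigma\in S_m\}$, i.e. the convex hull of those vertices whose coordinates indexed by $U_i$ are less than those indexed by $U_j$ for all $i<j$; it has dimension $m-n$. $\operatorname{Perm}(\mathcal K)$ is the polytopal complex consisting of the faces $F(U_1|\cdots|U_n)$ with $U_1,\dots,U_n\in\mathcal K$. Given orientations of the cells (vertices being oriented positively), the cellular chain group $C_p$ is free abelian on the $p$-dimensional cells, $\partial F=\sum_G[F:G]\,G$ where $G$ runs over the facets of $F$ and $[F:G]=\pm1$ is the sign comparing the orientation of $G$ with the one induced from $F$ (outward normal first); $C^p(\operatorname{Perm}(\mathcal K);\mathbf k)=\operatorname{Hom}(C_p,\mathbf k)$ with $d$ the dual of $\partial$, and $F^*$ is the cochain dual to a cell $F$. **The reduced bar construction.**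 Let $\Lambda[\mathcal K]=\Lambda[x_1,\dots,x_m]/(x_{i_1}\cdots x_{i_r}:\{i_1,\dots,i_r\}\notin\mathcal K)$ with $\deg x_i=1$, and for $S=\{i_1<\dots<i_r\}$ put $X_S=x_{i_1}\cdots x_{i_r}$. Let $I$ be the augmentation ideal of $A=\Lambda[\mathcal K]$, $\overline B^{-n}(A)=I^{\otimes n}$ with elements $[a_1|\cdots|a_n]$, and $$-\overline d[a_1|\cdots|a_n]=\sum_{i=1}^{n-1}[\overline a_1|\cdots|\overline a_{i-1}|\overline a_ia_{i+1}|a_{i+2}|\cdots|a_n],\qquad \overline a=(-1)^{\deg a+1}a .$$ The component $\overline B^{-n}(A)_{(1,\dots,1)}$ is the submodule spanned by the $[X_{S_1}|\cdots|X_{S_n}]$, $S_j\ne\varnothing$, in which the multidegrees of the monomials add up to $(1,\dots,1)$. **Theorem.** There is a choice of orientations of the cells of $\operatorname{Perm}(\mathcal K)$ for which the cellular boundary is given by Milgram's formula $$\partial F(U_1|\cdots|U_n)=\sum_{j=1}^{n}\ \sum_{\varnothing\ne M\subsetneq U_j}(-1)^{\varepsilon}\operatorname{shuff}(M;U_j\setminus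 M)\,F(U_1|\cdots|U_{j-1}|M|U_j\setminus M|U_{j+1}|\cdots|U_n),$$ $$\varepsilon=\sum_{i<j}(|U_i|-1)+|M|,\qquad \operatorname{shuff}(M;N)=(-1)^{\#\{(a,b)\in M\times N:\ b<a\}},$$ and, for these orientations, $\bigl(C^*(\operatorname{Perm}(\mathcal K);\mathbf k),d\bigr)$ and $(\overline B(\Lambda[\mathcal K]),\overline d)$ are complexes, the $(1,\dots,1)$-component is a subcomplex of the latter, and there is an isomorphism of cochain complexes $$\varphi\colon \bigl(C^p(\operatorname{Perm}(\mathcal K);\mathbf k),d\bigr)\xrightarrow{\ \cong\ }\bigl(\overline B^{\,p-m}(\Lambda[\mathcal K]),\overline d\bigr)_{(1,\dots,1)},\qquad F(U_1|\cdots|U_n)^*\longmapsto[X_{U_1}|\cdots|X_{U_n}]\quad(n=m-p).$$ In particular both sides vanish unless $0\le p\le m$. -/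

import Mathlib

open scoped DirectSum TensorProduct

noncomputable section

/-! ## Finite polytopal complexes and their cellular (co)chains -/

namespace Polytopal

variable {E : Type*} [AddCommGroup E] [Module ℝ E]

/-- The `p`-dimensional cells of a collection `P` of convex polytopes. -/
abbrev Cell (P : Set (Set E)) (p : ℕ) : Type _ :=
  {F : Set E // F ∈ P ∧ Module.finrank ℝ (vectorSpan ℝ F) = p}

/-- A choice of an orientation of every cell, that is, of the direction space of its affine hull.
As usual, the vertices are oriented positively. -/
structure CellOrientation (P : Set (Set E)) where
  /-- the orientation of a `p`-cell -/
  orient : ∀ (p : ℕ) (F : Cell P p), Orientation ℝ (vectorSpan ℝ F.1) (Fin p)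
  orient_vertex : ∀ F : Cell P 0, orient 0 F = positiveOrientation

variable {P : Set (Set E)}

/-- The orientation of the facet `G` of `F` is the one induced from `F`: an outward pointing vector
`x - y` with `x ∈ G` and `y ∈ F`, followed by a positively oriented basis of the direction space of
`G`, is a positively oriented basis of the direction space of `F`. -/
def IsInduced (o : CellOrientation P) {p : ℕ} (F : Cell P (p + 1)) (G : Cell P p) : Prop :=
  ∃ (bF : Module.Basis (Fin (p + 1)) ℝ (vectorSpan ℝ F.1))
    (bG : Module.Basis (Fin p) ℝ (vectorSpan ℝ G.1)),
    bF.orientation = o.orient (p + 1) F ∧ bG.orientation = o.orient p G ∧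
    (∃ x ∈ G.1, ∃ y ∈ F.1, (bF 0 : E) = x - y) ∧
    ∀ i : Fin p, (bF i.succ : E) = bG i

open Classical in
/-- The incidence number `[F : G]` of a `(p + 1)`-cell and a `p`-cell. -/
def incidence (o : CellOrientation P) {p : ℕ} (F : Cell P (p + 1)) (G : Cell P p) : ℤ :=
  if G.1 ⊆ F.1 then (if IsInduced o F G then 1 else -1) else 0

/-- The cellular chain group `C_p`, free abelian on the `p`-cells. -/
abbrev Chain (P : Set (Set E)) (p : ℕ) : Type _ := Cell P p →₀ ℤ

/-- The cellular boundary `∂ F = ∑ [F : G] G`. -/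
def boundary (o : CellOrientation P) (p : ℕ) : Chain P (p + 1) →ₗ[ℤ] Chain P p :=
  Finsupp.linearCombination ℤ fun F => ∑ᶠ G : Cell P p, Finsupp.single G (incidence o F G)

variable (P) in
/-- The cellular cochain group `C^p = Hom(C_p, k)`. -/
abbrev Cochain (k : Type*) [CommRing k] (p : ℕ) : Type _ := Chain P p →ₗ[ℤ] k

/-- The cellular coboundary, the dual of the boundary. -/
def coboundary (k : Type*) [CommRing k] (o : CellOrientation P) (p : ℕ) :
    Cochain P k p →ₗ[k] Cochain P k (p + 1) where
  toFun c := c ∘ₗ boundary o p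
  map_add' _ _ := rfl
  map_smul' _ _ := rfl

open Classical in
/-- The cochain `F*` dual to a cell `F`: it is `1` on `F` and `0` on the other cells. -/
def dualCochain (k : Type*) [CommRing k] {p : ℕ} (F : Cell P p) : Cochain P k p :=
  Finsupp.linearCombination ℤ fun G => if G = F then (1 : k) else 0

end Polytopal

/-! ## The permutohedron and the permutohedral complex -/

namespace Permutohedral

/-- An ordered partition `(U_1 | ⋯ | U_n)` of an `m`-element set into `n` nonempty parts. -/
@[ext]
structure OrderedPartition (m n : ℕ) where
  /-- the parts -/
  part : Fin n → Finset (Fin m)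
  nonempty : ∀ j, (part j).Nonempty
  disjoint : ∀ i j, i ≠ j → Disjoint (part i) (part j)
  cover : ∀ a, ∃ j, a ∈ part j

/-- The vertex `(σ(1), …, σ(m))` of the permutohedron. -/
def vertex {m : ℕ} (σ : Equiv.Perm (Fin m)) : Fin m → ℝ := fun a => ((σ a : ℕ) : ℝ) + 1

/-- The face `F(U_1 | ⋯ | U_n)` of the permutohedron `conv {vertex σ}`: the convex hull of the
vertices whose coordinates in `U_i` are less than those in `U_j` whenever `i < j`. -/
def face {m n : ℕ} (U : OrderedPartition m n) : Set (Fin m → ℝ) :=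
  convexHull ℝ {v | ∃ σ : Equiv.Perm (Fin m), v = vertex σ ∧
    ∀ i j, i < j → ∀ a ∈ U.part i, ∀ b ∈ U.part j, σ a < σ b}

/-- All parts of the ordered partition are simplices of `K`. -/
def OrderedPartition.IsIn {m n : ℕ} (U : OrderedPartition m n)
    (K : AbstractSimplicialComplex (Fin m)) : Prop :=
  ∀ j, U.part j ∈ K.faces

/-- The permutohedral complex `Perm(K)`, given by its collection of cells: the faces
`F(U_1 | ⋯ | U_n)` of the permutohedron with all `U_j ∈ K`. -/
def permComplex {m : ℕ} (K : AbstractSimplicialComplex (Fin m)) : Set (Set (Fin m → ℝ)) :=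
  {F | ∃ (n : ℕ) (U : OrderedPartition m n), U.IsIn K ∧ F = face U}

/-- The sign `shuff(M; N)` of the permutation that lists the elements of `M` in increasing order and
then those of `N` in increasing order: `-1` to the number of inversions. -/
def shuff {m : ℕ} (M N : Finset (Fin m)) : ℤ :=
  (-1) ^ ((M ×ˢ N).filter fun q => q.2 < q.1).card

/-- The refinement `(U_1 | ⋯ | U_{j-1} | M | U_j \ M | U_{j+1} | ⋯ | U_n)`. -/
def OrderedPartition.split {m n : ℕ} (U : OrderedPartition m n) (j : Fin n)
    (M : Finset (Fin m)) (hM : M.Nonempty) (hMU : M ⊂ U.part j) : OrderedPartition m (n + 1) where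
  part i :=
    if h : (i : ℕ) < j then U.part ⟨i, h.trans j.2⟩
    else if (i : ℕ) = j then M
    else if (i : ℕ) = j + 1 then U.part j \ M
    else U.part ⟨i - 1, by have := i.2; have := j.2; omega⟩
  nonempty i := by
    have hd : (U.part j \ M).Nonempty := Finset.sdiff_nonempty.2 hMU.2
    split_ifs
    exacts [U.nonempty _, hM, hd, U.nonempty _]
  disjoint := by
    have key : ∀ a b : Fin n, a ≠ b → Disjoint (U.part a) (U.part b) := U.disjoint
    have keyM : ∀ a : Fin n, a ≠ j → Disjoint (U.part a) M := fun a h =>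
      (U.disjoint a j h).mono_right hMU.1
    have keyN : ∀ a : Fin n, a ≠ j → Disjoint (U.part a) (U.part j \ M) := fun a h =>
      (U.disjoint a j h).mono_right Finset.sdiff_subset
    have hMN : Disjoint M (U.part j \ M) := Finset.disjoint_sdiff
    intro a b hab
    have hab' : (a : ℕ) ≠ b := fun h => hab (Fin.ext h)
    split_ifs <;>
      first
      | exact hMN
      | exact hMN.symm
      | (exfalso; omega)
      | (refine key _ _ ?_; simp only [ne_eq, Fin.mk.injEq]; omega)
      | (refine keyM _ ?_; rw [ne_eq, Fin.ext_iff]; dsimp only; omega)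
      | (refine keyN _ ?_; rw [ne_eq, Fin.ext_iff]; dsimp only; omega)
      | (refine (keyM _ ?_).symm; rw [ne_eq, Fin.ext_iff]; dsimp only; omega)
      | (refine (keyN _ ?_).symm; rw [ne_eq, Fin.ext_iff]; dsimp only; omega)
  cover a := by
    obtain ⟨l, hl⟩ := U.cover a
    rcases lt_trichotomy (l : ℕ) j with h | h | h
    · exact ⟨l.castSucc, by simpa [h] using hl⟩
    · obtain rfl : l = j := Fin.ext h
      by_cases ha : a ∈ M
      · exact ⟨l.castSucc, by simpa using ha⟩
      · exact ⟨l.succ, by simpa [hl] using ha⟩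
    · refine ⟨l.succ, ?_⟩
      have h1 : ¬ ((l : ℕ) + 1 < j) := by omega
      have h2 : ¬ ((l : ℕ) + 1 = j) := by omega
      have h3 : ¬ ((l : ℕ) = j) := by omega
      simpa [h1, h2, h3] using hl

/-- The sign `(-1)^ε shuff(M; U_j \ M)`, `ε = m_1 + ⋯ + m_{j-1} + |M|`, `m_i = |U_i| - 1`. -/
def milgramSign {m n : ℕ} (U : OrderedPartition m n) (j : Fin n) (M : Finset (Fin m)) : ℤ :=
  (-1) ^ ((∑ i ∈ Finset.univ.filter (· < j), ((U.part i).card - 1)) + M.card) *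
    shuff M (U.part j \ M)

/-- The right-hand side of Milgram's formula
`∂ F(U_1 | ⋯ | U_n) = ∑_j ∑_M (-1)^ε shuff(M; U_j \ M) F(U_1 | ⋯ | M | U_j \ M | ⋯ | U_n)`,
the sum over the nonempty proper subsets `M` of `U_j`, as a formal combination of faces. -/
def milgramBoundary {m n : ℕ} (U : OrderedPartition m n) : Set (Fin m → ℝ) →₀ ℤ :=
  ∑ j : Fin n, ∑ M : {M : Finset (Fin m) // M.Nonempty ∧ M ⊂ U.part j},
    Finsupp.single (face (U.split j M.1 M.2.1 M.2.2)) (milgramSign U j M.1)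

end Permutohedral

/-! ## The reduced bar construction of a connected graded algebra -/

namespace BarConstruction

variable {k A : Type*} [CommRing k] [Ring A] [Algebra k A]
  (𝒜 : ℕ → Submodule k A) [GradedAlgebra 𝒜]

/-- The augmentation ideal `I(A)`, the kernel of the projection to degree `0`. -/
def augIdeal : Submodule k A := LinearMap.ker (GradedAlgebra.proj 𝒜 0)

theorem mem_augIdeal {a : A} : a ∈ augIdeal 𝒜 ↔ GradedRing.projZeroRingHom 𝒜 a = 0 := by
  simp [augIdeal, GradedAlgebra.proj_apply]

theorem mem_augIdeal_of_mem {a : A} {d : ℕ} (hd : d ≠ 0) (ha : a ∈ 𝒜 d) : a ∈ augIdeal 𝒜 := by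
  rw [mem_augIdeal, GradedRing.projZeroRingHom_apply]
  exact DirectSum.decompose_of_mem_ne 𝒜 ha hd

/-- The linear map `a ↦ ā` of `A`, with `ā = (-1)^(deg a + 1) a` for homogeneous `a`. -/
def sgnMap : A →ₗ[k] A :=
  (DirectSum.toModule k ℕ A fun d => ((-1 : k) ^ (d + 1)) • (𝒜 d).subtype) ∘ₗ
    (DirectSum.decomposeLinearEquiv 𝒜).toLinearMap

theorem sgnMap_of_mem {a : A} {d : ℕ} (ha : a ∈ 𝒜 d) : sgnMap 𝒜 a = (-1 : k) ^ (d + 1) • a := by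
  simp only [sgnMap, LinearMap.comp_apply, LinearEquiv.coe_coe,
    DirectSum.decomposeLinearEquiv_apply]
  rw [DirectSum.decompose_of_mem 𝒜 ha]
  erw [DirectSum.toModule_lof]
  simp

theorem sgnMap_mem {a : A} (ha : a ∈ augIdeal 𝒜) : sgnMap 𝒜 a ∈ augIdeal 𝒜 := by
  have h : ∀ a : A, GradedAlgebra.proj 𝒜 0 (sgnMap 𝒜 a) = - GradedAlgebra.proj 𝒜 0 a := by
    intro a
    induction a using DirectSum.Decomposition.inductionOn 𝒜 with
    | zero => simp
    | homogeneous a =>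
      rename_i d
      rw [sgnMap_of_mem 𝒜 a.2, map_smul]
      rcases Nat.eq_zero_or_pos d with rfl | hd
      · simp
      · have : GradedAlgebra.proj 𝒜 0 (a : A) = 0 := by
          rw [GradedAlgebra.proj_apply]
          exact DirectSum.decompose_of_mem_ne 𝒜 a.2 hd.ne'
        simp [this]
    | add a b ha hb => rw [map_add, map_add, map_add, ha, hb]; abel
  have ha' : GradedAlgebra.proj 𝒜 0 a = 0 := ha
  change GradedAlgebra.proj 𝒜 0 (sgnMap 𝒜 a) = 0
  rw [h, ha', neg_zero]

/-- The map `a ↦ ā` on the augmentation ideal. -/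
def sgn : augIdeal 𝒜 →ₗ[k] augIdeal 𝒜 := (sgnMap 𝒜).restrict fun _ => sgnMap_mem 𝒜

/-- The product of the augmentation ideal. -/
def mulI : augIdeal 𝒜 →ₗ[k] augIdeal 𝒜 →ₗ[k] augIdeal 𝒜 :=
  LinearMap.mk₂ k (fun a b => ⟨a.1 * b.1, by
      have ha := (mem_augIdeal 𝒜).1 a.2
      rw [mem_augIdeal, map_mul, ha, zero_mul]⟩)
    (fun a b c => Subtype.ext (add_mul _ _ _)) (fun t a b => Subtype.ext (smul_mul_assoc _ _ _))
    (fun a b c => Subtype.ext (mul_add _ _ _)) (fun t a b => Subtype.ext (mul_smul_comm _ _ _))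

/-- `B̄^{-n}(A) = I(A) ⊗ ⋯ ⊗ I(A)` (`n` factors); `[a_1 | ⋯ | a_n]` is the pure tensor. -/
abbrev Bar (n : ℕ) : Type _ := ⨂[k] _ : Fin n, augIdeal 𝒜

/-- The tuple `(ā_1, …, ā_{i-1}, ā_i a_{i+1}, a_{i+2}, …, a_{n+1})`. -/
def mergeAt {n : ℕ} (i : Fin n) (a : Fin (n + 1) → augIdeal 𝒜) : Fin n → augIdeal 𝒜 := fun l =>
  if l < i then sgn 𝒜 (a l.castSucc)
  else if l = i then mulI 𝒜 (sgn 𝒜 (a i.castSucc)) (a i.succ)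
  else a l.succ

theorem mergeAt_update {n : ℕ} (i : Fin n) (a : Fin (n + 1) → augIdeal 𝒜) (t : Fin (n + 1)) :
    ∃ (l : Fin n) (f : augIdeal 𝒜 →ₗ[k] augIdeal 𝒜), ∀ z,
      mergeAt 𝒜 i (Function.update a t z) = Function.update (mergeAt 𝒜 i a) l (f z) := by
  rcases lt_trichotomy t i.castSucc with h | h | h
  · refine ⟨t.castLT (lt_trans h i.castSucc_lt_last), sgn 𝒜, fun z => ?_⟩
    funext l
    obtain ⟨t, ht⟩ := t
    obtain ⟨i, hi⟩ := i
    obtain ⟨l, hl⟩ := l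
    simp only [Fin.lt_def, Fin.val_castSucc] at h
    simp only [mergeAt, Function.update_apply, Fin.ext_iff, Fin.lt_def, Fin.val_castSucc,
      Fin.val_succ, Fin.castLT]
    split_ifs <;> first | rfl | (exfalso; omega)
  · refine ⟨i, (mulI 𝒜).flip (a i.succ) ∘ₗ sgn 𝒜, fun z => ?_⟩
    subst h
    funext l
    obtain ⟨i, hi⟩ := i
    obtain ⟨l, hl⟩ := l
    simp only [mergeAt, Function.update_apply, Fin.ext_iff, Fin.lt_def, Fin.val_castSucc,
      Fin.val_succ]
    split_ifs <;> first | rfl | (exfalso; omega)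
  · rcases eq_or_ne t i.succ with h' | h'
    · refine ⟨i, mulI 𝒜 (sgn 𝒜 (a i.castSucc)), fun z => ?_⟩
      subst h'
      funext l
      obtain ⟨i, hi⟩ := i
      obtain ⟨l, hl⟩ := l
      simp only [mergeAt, Function.update_apply, Fin.ext_iff, Fin.lt_def, Fin.val_castSucc,
        Fin.val_succ]
      split_ifs <;> first | rfl | (exfalso; omega)
    · refine ⟨⟨t - 1, by have := t.2; have := i.2; omega⟩, LinearMap.id, fun z => ?_⟩
      funext l
      obtain ⟨t, ht⟩ := t
      obtain ⟨i, hi⟩ := i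
      obtain ⟨l, hl⟩ := l
      simp only [Fin.lt_def, Fin.val_castSucc] at h
      simp only [ne_eq, Fin.ext_iff, Fin.val_succ] at h'
      simp only [mergeAt, Function.update_apply, Fin.ext_iff, Fin.lt_def, Fin.val_castSucc,
        Fin.val_succ]
      split_ifs <;> first | rfl | (exfalso; omega)

/-- The multilinear map `(a_j) ↦ [ā_1 | ⋯ | ā_{i-1} | ā_i a_{i+1} | a_{i+2} | ⋯ | a_{n+1}]`. -/
def mergeTerm (n : ℕ) (i : Fin n) :
    MultilinearMap k (fun _ : Fin (n + 1) => augIdeal 𝒜) (Bar 𝒜 n) where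
  toFun a := PiTensorProduct.tprod k (mergeAt 𝒜 i a)
  map_update_add' {inst} a t x y := by
    obtain rfl : inst = fun a b => instDecidableEqFin (n + 1) a b := Subsingleton.elim _ _
    obtain ⟨l, f, h⟩ := mergeAt_update 𝒜 i a t
    rw [h, h, h, map_add, MultilinearMap.map_update_add]
  map_update_smul' {inst} a t c x := by
    obtain rfl : inst = fun a b => instDecidableEqFin (n + 1) a b := Subsingleton.elim _ _
    obtain ⟨l, f, h⟩ := mergeAt_update 𝒜 i a t
    rw [h, h, map_smul, MultilinearMap.map_update_smul]

/-- The differential `B̄^{-(n+1)}(A) → B̄^{-n}(A)`,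
`-d̄ [a_1 | ⋯ | a_{n+1}] = ∑_i [ā_1 | ⋯ | ā_{i-1} | ā_i a_{i+1} | a_{i+2} | ⋯ | a_{n+1}]`. -/
def barDiff (n : ℕ) : Bar 𝒜 (n + 1) →ₗ[k] Bar 𝒜 n :=
  (-1 : k) • PiTensorProduct.lift (∑ i : Fin n, mergeTerm 𝒜 n i)

end BarConstruction

/-! ## The exterior Stanley–Reisner algebra -/

namespace StanleyReisner

open BarConstruction

variable (k : Type*) [CommRing k] {m : ℕ} (K : AbstractSimplicialComplex (Fin m))

/-- The generator `x_i` of `Λ[x_1, …, x_m]`. -/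
def gen (i : Fin m) : ExteriorAlgebra k (Fin m → k) := ExteriorAlgebra.ι k (Pi.single i 1)

/-- The monomial `x_S = x_{i_1} ⋯ x_{i_r}`, `S = {i_1 < ⋯ < i_r}`, of `Λ[x_1, …, x_m]`. -/
def extMonomial (S : Finset (Fin m)) : ExteriorAlgebra k (Fin m → k) :=
  ((S.sort (· ≤ ·)).map (gen k)).prod

/-- The relations `x_S = 0` for (nonempty) `S ∉ K`; they generate the Stanley–Reisner ideal. -/
inductive Rel : ExteriorAlgebra k (Fin m → k) → ExteriorAlgebra k (Fin m → k) → Prop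
  | of (S : Finset (Fin m)) (hS : S.Nonempty) (hK : S ∉ K.faces) : Rel (extMonomial k S) 0

/-- The exterior Stanley–Reisner algebra `Λ[K]`, the quotient of `Λ[x_1, …, x_m]` by the two-sided
ideal generated by the `x_S` with `S ∉ K`. -/
abbrev ExtSR : Type _ := RingQuot (Rel k K)

/-- The quotient map `Λ[x_1, …, x_m] → Λ[K]`. -/
def proj : ExteriorAlgebra k (Fin m → k) →ₐ[k] ExtSR k K := RingQuot.mkAlgHom k (Rel k K)

/-- The degree `d` part of `Λ[K]`, where `deg x_i = 1`. -/
def gr (d : ℕ) : Submodule k (ExtSR k K) := (⋀[k]^d (Fin m → k)).map (proj k K).toLinearMap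

instance : SetLike.GradedMonoid (gr k K) where
  one_mem := ⟨1, SetLike.GradedOne.one_mem (A := fun i : ℕ => ⋀[k]^i (Fin m → k)), map_one (proj k K)⟩
  mul_mem i j := by
    rintro _ _ ⟨a, ha, rfl⟩ ⟨b, hb, rfl⟩
    exact ⟨a * b, SetLike.GradedMul.mul_mem (A := fun i : ℕ => ⋀[k]^i (Fin m → k)) ha hb,
      map_mul (proj k K) _ _⟩

theorem extMonomial_mem (S : Finset (Fin m)) :
    extMonomial k S ∈ ⋀[k]^S.card (Fin m → k) := by
  have h : ∀ L : List (Fin m), (L.map (gen k)).prod ∈ ⋀[k]^L.length (Fin m → k) := by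
    intro L
    induction L with
    | nil => exact SetLike.GradedOne.one_mem (A := fun i : ℕ => ⋀[k]^i (Fin m → k))
    | cons a L ih =>
      rw [List.map_cons, List.prod_cons, List.length_cons, add_comm]
      refine SetLike.GradedMul.mul_mem (A := fun i : ℕ => ⋀[k]^i (Fin m → k)) ?_ ih
      change gen k a ∈ LinearMap.range (ExteriorAlgebra.ι k) ^ 1
      rw [pow_one]
      exact ⟨_, rfl⟩
  simpa [extMonomial] using h (S.sort (· ≤ ·))

/-- The decomposition of `Λ[x_1, …, x_m]` followed by the quotient map in every degree. -/
def gradedProj : ExteriorAlgebra k (Fin m → k) →ₐ[k] ⨁ d, gr k K d :=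
  ExteriorAlgebra.lift k ⟨DirectSum.lof k ℕ (fun d => gr k K d) 1 ∘ₗ
    ((proj k K).toLinearMap ∘ₗ ExteriorAlgebra.ι k).codRestrict _ fun v =>
      ⟨ExteriorAlgebra.ι k v, by
        change _ ∈ LinearMap.range (ExteriorAlgebra.ι k) ^ 1
        rw [pow_one]; exact ⟨_, rfl⟩, rfl⟩, fun v => by
      simp only [LinearMap.comp_apply, DirectSum.lof_eq_of]
      rw [DirectSum.of_mul_of]
      refine DFinsupp.single_eq_zero.mpr (Subtype.ext ?_)
      change proj k K _ * proj k K _ = 0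
      rw [← map_mul, ExteriorAlgebra.ι_sq_zero, map_zero]⟩

theorem gradedProj_of_mem {d : ℕ} {a : ExteriorAlgebra k (Fin m → k)}
    (ha : a ∈ ⋀[k]^d (Fin m → k)) :
    gradedProj k K a = DirectSum.of (fun d => gr k K d) d ⟨proj k K a, a, ha, rfl⟩ := by
  induction ha using Submodule.pow_induction_on_left' with
  | algebraMap r =>
    rw [AlgHom.commutes, DirectSum.algebraMap_apply]
    congr 1
    exact Subtype.ext ((proj k K).commutes r).symm
  | add x y i hx hy ihx ihy =>
    rw [map_add, ihx, ihy, ← map_add]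
    congr 1
    exact Subtype.ext (map_add _ _ _).symm
  | mem_mul v hv i x hx ih =>
    obtain ⟨v, rfl⟩ := hv
    rw [map_mul, ih, gradedProj, ExteriorAlgebra.lift_ι_apply]
    simp only [LinearMap.comp_apply, DirectSum.lof_eq_of]
    rw [DirectSum.of_mul_of]
    refine DirectSum.of_eq_of_gradedMonoid_eq (Sigma.subtype_ext (add_comm _ _) ?_)
    exact (map_mul (proj k K) _ _).symm

theorem gradedProj_rel ⦃a b : ExteriorAlgebra k (Fin m → k)⦄ (h : Rel k K a b) :
    gradedProj k K a = gradedProj k K b := by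
  have h' : proj k K a = proj k K b := RingQuot.mkAlgHom_rel k h
  obtain ⟨S, hS, hK⟩ := h
  rw [gradedProj_of_mem k K (extMonomial_mem k S), map_zero]
  refine DFinsupp.single_eq_zero.mpr (Subtype.ext ?_)
  rw [map_zero] at h'
  exact h'

instance : GradedAlgebra (gr k K) :=
  GradedAlgebra.ofAlgHom _ (RingQuot.liftAlgHom k ⟨gradedProj k K, gradedProj_rel k K⟩)
    (by
      apply RingQuot.ringQuot_ext'
      apply ExteriorAlgebra.hom_ext
      ext v
      simp only [LinearMap.comp_apply, AlgHom.toLinearMap_apply, AlgHom.comp_apply, AlgHom.id_apply,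
        RingQuot.liftAlgHom_mkAlgHom_apply]
      rw [gradedProj, ExteriorAlgebra.lift_ι_apply]
      simp only [LinearMap.comp_apply, DirectSum.lof_eq_of, DirectSum.coeAlgHom_of]
      rfl)
    (by
      rintro d ⟨_, a, ha, rfl⟩
      change RingQuot.liftAlgHom k _ (RingQuot.mkAlgHom k _ a) = _
      rw [RingQuot.liftAlgHom_mkAlgHom_apply, gradedProj_of_mem k K ha]
      rfl)

/-- The monomial `x_S` of `Λ[K]`, for nonempty `S`, as an element of the augmentation ideal. -/
def monomial (S : Finset (Fin m)) (hS : S.Nonempty) : augIdeal (gr k K) :=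
  ⟨proj k K (extMonomial k S),
    mem_augIdeal_of_mem (gr k K) hS.card_pos.ne' ⟨_, extMonomial_mem k S, rfl⟩⟩

/-- The element `[x_{S_1} | ⋯ | x_{S_n}]` of the reduced bar construction of `Λ[K]`. -/
def barMonomial {n : ℕ} (S : Fin n → Finset (Fin m)) (hS : ∀ j, (S j).Nonempty) :
    Bar (gr k K) n :=
  PiTensorProduct.tprod k fun j => monomial k K (S j) (hS j)

/-- The multidegree of the monomial `x_S`. -/
def mdeg (S : Finset (Fin m)) : Fin m → ℕ := fun i => if i ∈ S then 1 else 0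

/-- The component of multidegree `α` of `B̄^{-n}(Λ[K])`, spanned by the `[x_{S_1} | ⋯ | x_{S_n}]`
with `mdeg x_{S_1} + ⋯ + mdeg x_{S_n} = α`. -/
def barComponent (n : ℕ) (α : Fin m → ℕ) : Submodule k (Bar (gr k K) n) :=
  Submodule.span k {t | ∃ (S : Fin n → Finset (Fin m)) (hS : ∀ j, (S j).Nonempty),
    ∑ j, mdeg (S j) = α ∧ t = barMonomial k K S hS}

end StanleyReisner

end

open Polytopal Permutohedral BarConstruction StanleyReisner

/-! ## Combinatorics of ordered partitions -/

namespace Permutohedral.OrderedPartition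

variable {m n : ℕ}

/-! Both complexes are free on the same set: the ordered partitions of the vertex set into `n`
simplices. On the geometric side, `vectorSpan_face` identifies the direction space of `face U` with
the vectors whose coordinates sum to zero over every part, so the dimension is `m - n`, and
`face_subset_face_iff` shows that inclusion of faces is refinement. On the algebraic side,
multidegree `(1, …, 1)` forces the supports of the monomials to form an ordered partition; a bar
monomial with a part outside `K` vanishes, and the others are independent because `barCoeff`
supplies dual functionals.

The differentials match because splitting one part and uniting two neighbouring parts are inverse
operations (`splitEquiv`). The coboundary at `U` runs over the splittings of `U`, the bar
differential of `W` over the places where `W` can be merged. What remains is to see Milgram's sign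
on both sides. In the bar construction it comes from the products `x_M x_N = ± x_{M ∪ N}` and from
the signs of the bars (`barDiff_barMonomial`).

In geometry a face is oriented by a determinant: `p` tangent vectors are completed to a square
matrix by the indicator vectors of the parts, and the result is normalised by `orientSign`. Passing
to a facet replaces the indicator of `U_j` by those of `M` and `U_j \ M`. Row operations compare the
two determinants, and the parity count `orientSign_splitting` turns the outcome into the Milgram
sign (`orientForm_cons`). A vector pointing outward at this facet has nonpositive coordinate sum
over `M`, since that sum is minimal on the facet (`sum_le_sum_of_mem_face`); hence the incidence
number is exactly the Milgram sign (`incidence_splitting`).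

The bar differential squares to zero by a cancelling involution on pairs of merges; the same fact
for the coboundary is then transported through the isomorphism. -/

/-- The index of the part that contains `a`. -/
noncomputable def idx (U : OrderedPartition m n) (a : Fin m) : Fin n := (U.cover a).choose

theorem mem_part_idx (U : OrderedPartition m n) (a : Fin m) : a ∈ U.part (U.idx a) :=
  (U.cover a).choose_spec

theorem mem_part (U : OrderedPartition m n) {a : Fin m} {j : Fin n} :
    a ∈ U.part j ↔ U.idx a = j := by
  refine ⟨fun h => ?_, fun h => h ▸ U.mem_part_idx a⟩
  by_contra hne
  exact Finset.disjoint_left.1 (U.disjoint _ _ hne) (U.mem_part_idx a) h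

theorem part_eq_filter (U : OrderedPartition m n) (j : Fin n) :
    U.part j = Finset.univ.filter (U.idx · = j) := by
  ext a; simp [mem_part]

theorem idx_surjective (U : OrderedPartition m n) : Function.Surjective U.idx := fun j => by
  obtain ⟨a, ha⟩ := U.nonempty j
  exact ⟨a, U.mem_part.1 ha⟩

/-- An ordered partition is encoded by a surjection onto `Fin n`. This turns later identities of
partitions into arithmetic with indices, and also gives finiteness. -/
theorem idx_injective : Function.Injective (idx : OrderedPartition m n → Fin m → Fin n) := by
  intro U W h
  ext j a
  rw [mem_part, mem_part, h]

/-- The ordered partition into the fibres of a surjection. -/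
def ofIdx (f : Fin m → Fin n) (hf : Function.Surjective f) : OrderedPartition m n where
  part j := Finset.univ.filter (f · = j)
  nonempty j := by
    obtain ⟨a, ha⟩ := hf j
    exact ⟨a, by simpa using ha⟩
  disjoint i j hij := by
    rw [Finset.disjoint_left]
    intro a ha hb
    simp only [Finset.mem_filter, Finset.mem_univ, true_and] at ha hb
    exact hij (ha.symm.trans hb)
  cover a := ⟨f a, by simp⟩

theorem idx_ofIdx (f : Fin m → Fin n) (hf : Function.Surjective f) : (ofIdx f hf).idx = f := by
  funext a
  exact (ofIdx f hf).mem_part.1 (by simp [ofIdx])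

instance : Finite (OrderedPartition m n) := Finite.of_injective _ idx_injective

noncomputable instance : Fintype (OrderedPartition m n) := Fintype.ofFinite _

theorem card_le (U : OrderedPartition m n) : n ≤ m := by
  simpa using Fintype.card_le_of_surjective _ U.idx_surjective

/-! ### Uniting neighbouring parts and splitting a part. -/

theorem val_predAbove (i : Fin n) (x : Fin (n + 1)) :
    (i.predAbove x : ℕ) = if (x : ℕ) ≤ i then (x : ℕ) else (x : ℕ) - 1 := by
  simp only [Fin.predAbove, Fin.lt_def, Fin.val_castSucc]
  split_ifs <;> simp <;> omega

/-- The ordered partition in which the parts number `i` and `i + 1` are united. -/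
noncomputable def merge (W : OrderedPartition m (n + 1)) (i : Fin n) : OrderedPartition m n :=
  ofIdx (fun a => i.predAbove (W.idx a)) ((Fin.predAbove_surjective i).comp W.idx_surjective)

theorem idx_merge (W : OrderedPartition m (n + 1)) (i : Fin n) (a : Fin m) :
    (W.merge i).idx a = i.predAbove (W.idx a) := by
  rw [merge, idx_ofIdx]

theorem part_merge (W : OrderedPartition m (n + 1)) (i l : Fin n) :
    (W.merge i).part l = if l < i then W.part l.castSucc
      else if l = i then W.part i.castSucc ∪ W.part i.succ else W.part l.succ := by
  ext a
  rw [mem_part, idx_merge]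
  have key : ∀ x : Fin (n + 1), i.predAbove x = l ↔
      if l < i then x = l.castSucc else if l = i then x = i.castSucc ∨ x = i.succ
        else x = l.succ := by
    intro x
    obtain ⟨x, hx⟩ := x
    obtain ⟨i, hi⟩ := i
    obtain ⟨l, hl⟩ := l
    simp only [Fin.predAbove, Fin.lt_def, Fin.ext_iff, Fin.val_castSucc, Fin.val_succ]
    split_ifs <;> simp <;> omega
  rw [key]
  split_ifs <;> simp [mem_part]

theorem idx_split (U : OrderedPartition m n) (j : Fin n) (M : Finset (Fin m)) (hM : M.Nonempty)
    (hMU : M ⊂ U.part j) (a : Fin m) :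
    ((U.split j M hM hMU).idx a : ℕ) =
      if U.idx a < j then (U.idx a : ℕ) else if a ∈ M then (j : ℕ) else (U.idx a : ℕ) + 1 := by
  have hMj : a ∈ M → U.idx a = j := fun h => U.mem_part.1 (hMU.1 h)
  have key : ∀ l : Fin (n + 1), a ∈ (U.split j M hM hMU).part l →
      ((U.split j M hM hMU).idx a : ℕ) = l := fun l hl => by rw [(mem_part _).1 hl]
  rcases lt_trichotomy (U.idx a) j with h | h | h
  · rw [if_pos h]
    refine key (U.idx a).castSucc ?_
    simp only [split, Fin.val_castSucc]
    rw [dif_pos (by exact h)]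
    exact U.mem_part_idx a
  · rw [if_neg (by omega)]
    split_ifs with hm
    · exact key j.castSucc (by simpa [split] using hm)
    · exact key (U.idx a).succ (by simpa [split, h, hm] using h ▸ U.mem_part_idx a)
  · rw [if_neg (by omega), if_neg (fun h' => by have := hMj h'; omega)]
    refine key (U.idx a).succ ?_
    have h1 : ¬ ((U.idx a : ℕ) + 1 < j) := by omega
    have h2 : ¬ ((U.idx a : ℕ) + 1 = j) := by omega
    have h3 : ¬ ((U.idx a : ℕ) = j) := by omega
    simpa [split, h1, h2, h3] using U.mem_part_idx a

theorem part_split_castSucc (U : OrderedPartition m n) (j : Fin n) (M : Finset (Fin m))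
    (hM : M.Nonempty) (hMU : M ⊂ U.part j) : (U.split j M hM hMU).part j.castSucc = M := by
  simp [split]

theorem part_split_succ (U : OrderedPartition m n) (j : Fin n) (M : Finset (Fin m))
    (hM : M.Nonempty) (hMU : M ⊂ U.part j) :
    (U.split j M hM hMU).part j.succ = U.part j \ M := by
  simp [split]

theorem merge_split (U : OrderedPartition m n) (j : Fin n) (M : Finset (Fin m)) (hM : M.Nonempty)
    (hMU : M ⊂ U.part j) : (U.split j M hM hMU).merge j = U := by
  refine idx_injective (funext fun a => ?_)
  have h := U.idx_split j M hM hMU a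
  have hMj : a ∈ M → U.idx a = j := fun h => U.mem_part.1 (hMU.1 h)
  rw [idx_merge]
  ext
  rw [val_predAbove]
  simp only [Fin.lt_def, Fin.ext_iff] at h hMj
  by_cases ha : a ∈ M
  · have := hMj ha
    split_ifs at h ⊢ <;> omega
  · split_ifs at h ⊢ <;> omega

theorem part_castSucc_ssubset (W : OrderedPartition m (n + 1)) (i : Fin n) :
    W.part i.castSucc ⊂ (W.merge i).part i := by
  rw [part_merge, if_neg (lt_irrefl _), if_pos rfl]
  refine ⟨Finset.subset_union_left, fun h => ?_⟩
  obtain ⟨a, ha⟩ := W.nonempty i.succ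
  have h1 := W.mem_part.1 ha
  have h2 := W.mem_part.1 (h (Finset.mem_union_right _ ha))
  rw [h1, Fin.ext_iff] at h2
  simp at h2

theorem split_merge (W : OrderedPartition m (n + 1)) (i : Fin n) :
    (W.merge i).split i (W.part i.castSucc) (W.nonempty _) (W.part_castSucc_ssubset i) = W := by
  refine idx_injective (funext fun a => ?_)
  ext
  rw [idx_split, idx_merge]
  simp only [mem_part, Fin.predAbove, Fin.lt_def, Fin.ext_iff, Fin.val_castSucc]
  split_ifs <;> simp at * <;> omega

/-- The ways to split a part of an ordered partition into `n` parts. -/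
abbrev Splitting (U : OrderedPartition m n) : Type :=
  Σ j : Fin n, {M : Finset (Fin m) // M.Nonempty ∧ M ⊂ U.part j}

/-- The ordered partition resulting from a splitting. -/
abbrev Splitting.apply {U : OrderedPartition m n} (s : U.Splitting) : OrderedPartition m (n + 1) :=
  U.split s.1 s.2.1 s.2.2.1 s.2.2.2

theorem Splitting.idx_apply {U : OrderedPartition m n} (s : U.Splitting) (a : Fin m) :
    (s.apply.idx a : ℕ) = if U.idx a < s.1 then (U.idx a : ℕ)
      else if a ∈ s.2.1 then (s.1 : ℕ) else (U.idx a : ℕ) + 1 :=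
  U.idx_split s.1 s.2.1 s.2.2.1 s.2.2.2 a

theorem Splitting.idx_eq {U : OrderedPartition m n} (s : U.Splitting) {a : Fin m}
    (ha : a ∈ s.2.1) : (U.idx a : ℕ) = s.1 :=
  congrArg Fin.val (U.mem_part.1 (s.2.2.2.1 ha))

theorem Splitting.merge_apply {U : OrderedPartition m n} (s : U.Splitting) :
    s.apply.merge s.1 = U := U.merge_split s.1 s.2.1 s.2.2.1 s.2.2.2

/-- If two splittings act at places `j < j'`, then the second leaves `U_j` whole while the first
puts a proper subset of it at place `j`. At equal places the set `M` is read off as the part number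
`j`. -/
theorem Splitting.apply_injective (U : OrderedPartition m n) :
    Function.Injective (Splitting.apply : U.Splitting → _) := by
  have aux : ∀ s s' : U.Splitting, s.1 < s'.1 → s.apply ≠ s'.apply := by
    intro s s' hlt h
    have e1 : s'.apply.part s.1.castSucc = U.part s.1 := by
      simp only [Splitting.apply, split, Fin.val_castSucc]
      rw [dif_pos (by exact hlt)]
    rw [← h, Splitting.apply, part_split_castSucc] at e1
    exact s.2.2.2.ne e1
  intro s s' h
  rcases lt_trichotomy s.1 s'.1 with hlt | heq | hlt
  · exact absurd h (aux _ _ hlt)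
  · obtain ⟨j, M, hM⟩ := s
    obtain ⟨j', M', hM'⟩ := s'
    obtain rfl : j = j' := heq
    have := congrArg (fun W => part W j.castSucc) h
    simp only [Splitting.apply, part_split_castSucc] at this
    subst this
    rfl
  · exact absurd h.symm (aux _ _ hlt)

/-- Splitting a part and uniting two consecutive parts are inverse to each other. -/
noncomputable def splitEquiv (m n : ℕ) :
    (Σ U : OrderedPartition m n, U.Splitting) ≃ OrderedPartition m (n + 1) × Fin n :=
  Equiv.ofBijective (fun x => (x.2.apply, x.2.1)) <| by
    constructor
    · rintro ⟨U, s⟩ ⟨U', s'⟩ h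
      simp only [Prod.mk.injEq] at h
      obtain rfl : U = U' := by
        have h1 := s.merge_apply
        rw [h.1, h.2, s'.merge_apply] at h1
        exact h1.symm
      rw [Splitting.apply_injective U h.1]
    · rintro ⟨W, i⟩
      exact ⟨⟨W.merge i, i, W.part i.castSucc, W.nonempty _, W.part_castSucc_ssubset i⟩,
        Prod.ext (W.split_merge i) rfl⟩

/-- An ordered partition that refines another one with one part less is a splitting of it. -/
theorem exists_splitting {U : OrderedPartition m n} {W : OrderedPartition m (n + 1)}
    (h : ∀ a b, U.idx a < U.idx b → W.idx a < W.idx b) : ∃ s : U.Splitting, s.apply = W := by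
  suffices ∃ i, W.merge i = U by
    obtain ⟨i, rfl⟩ := this
    exact ⟨⟨i, W.part i.castSucc, W.nonempty _, W.part_castSucc_ssubset i⟩, W.split_merge i⟩
  have hsec : ∀ l, ∃ a, W.idx a = l := W.idx_surjective
  choose s hs using hsec
  have hle : ∀ a b, W.idx a ≤ W.idx b → U.idx a ≤ U.idx b := fun a b hab =>
    not_lt.1 fun h' => absurd (h _ _ h') (not_lt.2 hab)
  have hπ : ∀ a, U.idx (s (W.idx a)) = U.idx a := fun a =>
    le_antisymm (hle _ _ (hs _).le) (hle _ _ (hs _).ge)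
  -- Refinement means that the index in `U` is a monotone function of the index in `W`.
  let π : Fin (n + 1) →o Fin n := ⟨fun l => U.idx (s l), fun l l' hll => hle _ _ (by rwa [hs, hs])⟩
  have hsurj : Function.Surjective π := fun j => by
    obtain ⟨a, rfl⟩ := U.idx_surjective j
    exact ⟨W.idx a, hπ a⟩
  have hex : ∃ i : Fin n, ∀ l, π l = i.predAbove l := by
    rcases n with _ | n
    · exact (π 0).elim0
    -- A monotone surjection onto a chain with one element less is a degeneracy, that is, some
    -- `predAbove`. After the case split the target has `n + 1` elements, as the object `mk n`
    -- requires.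
    · let θ : SimplexCategory.mk (n + 1) ⟶ SimplexCategory.mk n := SimplexCategory.Hom.mk π
      have : CategoryTheory.Epi θ := SimplexCategory.epi_iff_surjective.2 hsurj
      obtain ⟨i, hi⟩ := SimplexCategory.eq_σ_of_epi θ
      refine ⟨i, fun l => ?_⟩
      have : π l = θ.toOrderHom l := rfl
      rw [this, hi]
      rfl
  obtain ⟨i, hi⟩ := hex
  refine ⟨i, idx_injective (funext fun a => ?_)⟩
  rw [idx_merge, ← hi]
  exact hπ a

theorem idx_split_lt {U : OrderedPartition m n} (s : U.Splitting) {a b : Fin m}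
    (h : U.idx a < U.idx b) : s.apply.idx a < s.apply.idx b := by
  have ha := s.idx_apply a
  have hb := s.idx_apply b
  have hMa : a ∈ s.2.1 → (U.idx a : ℕ) = s.1 := s.idx_eq
  have hMb : b ∈ s.2.1 → (U.idx b : ℕ) = s.1 := s.idx_eq
  rw [Fin.lt_def]
  split_ifs at ha hb <;> simp_all <;> omega

/-- Ordered partitions with equally many parts that induce the same order are equal. -/
theorem eq_of_idx_lt {U W : OrderedPartition m n}
    (h : ∀ a b, U.idx a < U.idx b ↔ W.idx a < W.idx b) : U = W := by
  have hsec : ∀ l, ∃ a, U.idx a = l := U.idx_surjective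
  choose s hs using hsec
  have hmono : StrictMono fun l => W.idx (s l) := fun l l' hl => (h _ _).1 (by rwa [hs, hs])
  -- A finite chain has no order automorphism besides the identity.
  have hid : ∀ l, W.idx (s l) = l := fun l => by
    have := Subsingleton.elim (OrderIso.ofRelIsoLT
      (StrictMono.orderIsoOfSurjective _ hmono (Finite.surjective_of_injective hmono.injective)).toRelIsoLT) (OrderIso.refl _)
    exact DFunLike.congr_fun this l
  refine idx_injective (funext fun a => ?_)
  have e : W.idx (s (U.idx a)) = W.idx a := by
    refine le_antisymm (not_lt.1 fun h' => ?_) (not_lt.1 fun h' => ?_) <;>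
    · have := (h _ _).2 h'
      rw [hs] at this
      exact lt_irrefl _ this
  rw [← e, hid]

theorem IsIn.splitting {K : AbstractSimplicialComplex (Fin m)} {U : OrderedPartition m n}
    (hU : U.IsIn K) (s : U.Splitting) : s.apply.IsIn K := by
  have key : ∀ (j : Fin n) (M : Finset (Fin m)), M.Nonempty → M ⊆ U.part j → M ∈ K.faces :=
    fun j M hM hMU => (K.isRelLowerSet_faces (hU j)).2 hMU hM
  intro l
  have hne := s.apply.nonempty l
  obtain ⟨a, ha⟩ := hne
  refine key (U.idx a) _ ⟨a, ha⟩ fun b hb => ?_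
  rw [mem_part] at *
  rw [← s.merge_apply, idx_merge, idx_merge, ha, hb]

/-! ### Signs -/

/-- The sign by which the orientation of a face differs from the one given by a determinant. -/
noncomputable def orientSign (U : OrderedPartition m n) : ℤ :=
  (-1) ^ ((Finset.univ.filter fun q : Fin m × Fin m => q.1 < q.2 ∧ U.idx q.2 < U.idx q.1).card +
    ∑ a, (U.idx a : ℕ) + ∑ i : Fin n, (i : ℕ))

theorem orientSign_mul_self (U : OrderedPartition m n) : U.orientSign * U.orientSign = 1 := by
  rw [orientSign, ← pow_add, Even.neg_one_pow (Even.add_self _)]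

/-- Splitting keeps the old inversions and creates one for each element of `M` exceeding an element
of `U_j \ M`. The swap of coordinates is needed because inversions list the smaller element first,
whereas `shuff` lists the element of `M` first. -/
theorem card_inversions_splitting {U : OrderedPartition m n} (s : U.Splitting) :
    (Finset.univ.filter fun q : Fin m × Fin m =>
        q.1 < q.2 ∧ s.apply.idx q.2 < s.apply.idx q.1).card =
      (Finset.univ.filter fun q : Fin m × Fin m => q.1 < q.2 ∧ U.idx q.2 < U.idx q.1).card +
      ((s.2.1 ×ˢ (U.part s.1 \ s.2.1)).filter fun q => q.2 < q.1).card := by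
  rw [← Finset.card_map (f := (Equiv.prodComm (Fin m) (Fin m)).toEmbedding)
    (s := (s.2.1 ×ˢ (U.part s.1 \ s.2.1)).filter fun q => q.2 < q.1)]
  rw [← Finset.card_union_of_disjoint]
  · congr 1
    ext ⟨a, b⟩
    have ha := s.idx_apply a
    have hb := s.idx_apply b
    have hMa : a ∈ s.2.1 → (U.idx a : ℕ) = s.1 := s.idx_eq
    have hMb : b ∈ s.2.1 → (U.idx b : ℕ) = s.1 := s.idx_eq
    simp only [Finset.mem_filter, Finset.mem_univ, true_and, Finset.mem_union, Finset.mem_map_equiv,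
      Finset.mem_product, Finset.mem_sdiff, mem_part, Equiv.prodComm_symm, Equiv.prodComm_apply,
      Prod.swap_prod_mk, Fin.lt_def]
    simp only [Fin.lt_def, Fin.ext_iff] at ha hb ⊢
    by_cases h1 : a ∈ s.2.1 <;> by_cases h2 : b ∈ s.2.1 <;>
      simp only [h1, h2, if_true, if_false, true_implies, and_true, true_and, not_true, not_false_iff, and_false, false_and, or_false] at * <;>
      split_ifs at ha hb <;> omega
  · rw [Finset.disjoint_left]
    rintro ⟨a, b⟩ h1 h2
    simp only [Finset.mem_filter, Finset.mem_univ, true_and, Finset.mem_map_equiv,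
      Finset.mem_product, Finset.mem_sdiff, mem_part, Equiv.prodComm_symm, Equiv.prodComm_apply,
      Prod.swap_prod_mk] at h1 h2
    have := U.mem_part.1 (s.2.2.2.1 h2.1.1)
    rw [this, h2.1.2.1] at h1
    exact lt_irrefl _ h1.2

/-- Every index rises by one, except for elements of earlier parts and of `M`. -/
theorem sum_idx_splitting {U : OrderedPartition m n} (s : U.Splitting) :
    ∑ a, (s.apply.idx a : ℕ) + (∑ i ∈ Finset.univ.filter (· < s.1), (U.part i).card + s.2.1.card) =
      ∑ a, (U.idx a : ℕ) + m := by
  have h1 : ∑ i ∈ Finset.univ.filter (· < s.1), (U.part i).card =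
      ∑ a, if U.idx a < s.1 then 1 else 0 := by
    rw [← Finset.card_filter, Finset.card_eq_sum_card_fiberwise (f := U.idx)
      (t := Finset.univ.filter (· < s.1)) (fun a ha => by simpa using ha)]
    refine Finset.sum_congr rfl fun i hi => ?_
    congr 1
    ext a
    simp only [Finset.mem_filter, Finset.mem_univ, true_and, mem_part] at hi ⊢
    exact ⟨fun h => ⟨h ▸ hi, h⟩, fun h => h.2⟩
  have h2 : s.2.1.card = ∑ a, if a ∈ s.2.1 then 1 else 0 := by simp
  have h3 : ∑ a, (U.idx a : ℕ) + m = ∑ a, ((U.idx a : ℕ) + 1) := by simp [Finset.sum_add_distrib]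
  rw [h1, h2, h3, ← Finset.sum_add_distrib, ← Finset.sum_add_distrib]
  refine Finset.sum_congr rfl fun a _ => ?_
  have ha := s.idx_apply a
  have hMa : a ∈ s.2.1 → (U.idx a : ℕ) = s.1 := s.idx_eq
  simp only [Fin.lt_def] at *
  split_ifs at * <;> simp_all

/-- A parity count. The inversions give `shuff`, the index sums give `m`, `|M|` and the sizes of the
earlier parts, and the sums over `Fin n` and `Fin (n + 1)` differ by `n`. As `m = p + 1 + n`,
everything left over cancels, and the extra `j` turns the sizes `|U_i|` into `|U_i| - 1`. -/
theorem orientSign_splitting {p : ℕ} (h : p + 1 + n = m) {U : OrderedPartition m n}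
    (s : U.Splitting) :
    U.orientSign * s.apply.orientSign * (-1) ^ (p + s.1 + 1 : ℕ) = milgramSign U s.1 s.2.1 := by
  have h1 := card_inversions_splitting s
  have h2 := sum_idx_splitting s
  have h3 : ∑ i ∈ Finset.univ.filter (· < s.1), (U.part i).card =
      ∑ i ∈ Finset.univ.filter (· < s.1), ((U.part i).card - 1) + (s.1 : ℕ) := by
    have : (s.1 : ℕ) = ∑ i ∈ Finset.univ.filter (· < s.1), 1 := by
      rw [Finset.sum_const, smul_eq_mul, mul_one]
      have : Finset.univ.filter (· < s.1) = Finset.Iio s.1 := by ext; simp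
      rw [this, Fin.card_Iio]
    conv_rhs => rw [this]
    rw [← Finset.sum_add_distrib]
    refine Finset.sum_congr rfl fun i _ => ?_
    have := (U.nonempty i).card_pos
    omega
  have h4 : ∑ i : Fin (n + 1), (i : ℕ) = ∑ i : Fin n, (i : ℕ) + n := by
    simp [Fin.sum_univ_castSucc]
  rw [milgramSign, orientSign, orientSign, shuff, ← pow_add, ← pow_add, ← pow_add]
  refine neg_one_pow_congr ?_
  simp only [Nat.even_iff]
  rw [h1, h4]
  omega

end Permutohedral.OrderedPartition

/-! ## The differential of the bar construction -/

namespace BarConstruction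

variable {k A : Type*} [CommRing k] [Ring A] [Algebra k A]
  (𝒜 : ℕ → Submodule k A) [GradedAlgebra 𝒜]

theorem sgnMap_sgnMap (a : A) : sgnMap 𝒜 (sgnMap 𝒜 a) = a := by
  induction a using DirectSum.Decomposition.inductionOn 𝒜 with
  | zero => simp
  | @homogeneous d a =>
    rw [sgnMap_of_mem 𝒜 a.2, map_smul, sgnMap_of_mem 𝒜 a.2, smul_smul, ← pow_add,
      Even.neg_one_pow (Even.add_self _), one_smul]
  | add a b ha hb => rw [map_add, map_add, ha, hb]

/-- The exponents `d + e + 1` and `(d + 1) + (e + 1)` have opposite parity; this is the source of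
all cancellation in the square of the bar differential. -/
theorem sgnMap_mul (a b : A) : sgnMap 𝒜 (a * b) = -(sgnMap 𝒜 a * sgnMap 𝒜 b) := by
  induction a using DirectSum.Decomposition.inductionOn 𝒜 with
  | zero => simp
  | add a a' ha ha' => rw [add_mul, map_add, map_add, ha, ha', add_mul, neg_add]
  | @homogeneous d a =>
    induction b using DirectSum.Decomposition.inductionOn 𝒜 with
    | zero => simp
    | add b b' hb hb' => rw [mul_add, map_add, map_add, hb, hb', mul_add, neg_add]
    | @homogeneous e b =>
      rw [sgnMap_of_mem 𝒜 a.2, sgnMap_of_mem 𝒜 b.2, sgnMap_of_mem 𝒜 (SetLike.mul_mem_graded a.2 b.2),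
        smul_mul_smul_comm, ← neg_smul]
      congr 1
      ring

theorem sgn_sgn (a : augIdeal 𝒜) : sgn 𝒜 (sgn 𝒜 a) = a := Subtype.ext (sgnMap_sgnMap 𝒜 a)

theorem sgn_mulI (a b : augIdeal 𝒜) :
    sgn 𝒜 (mulI 𝒜 a b) = -mulI 𝒜 (sgn 𝒜 a) (sgn 𝒜 b) := Subtype.ext (sgnMap_mul 𝒜 a b)

theorem mulI_assoc (a b c : augIdeal 𝒜) :
    mulI 𝒜 (mulI 𝒜 a b) c = mulI 𝒜 a (mulI 𝒜 b c) := Subtype.ext (mul_assoc a.1 b.1 c.1)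

/-- Doing two merges in either order gives the same tuple up to one sign, in the slot `j`: there a
bar is applied to a product on one side only. Slots further left carry two bars, which cancel. The
case `j = i'` is associativity. -/
theorem mergeAt_mergeAt {n : ℕ} (a : Fin (n + 2) → augIdeal 𝒜) (i : Fin (n + 1)) (j i' : Fin n)
    (hij : (j : ℕ) = i) (h : j ≤ i') :
    mergeAt 𝒜 i' (mergeAt 𝒜 i a) = Function.update (mergeAt 𝒜 j (mergeAt 𝒜 i'.succ a)) j
      (-mergeAt 𝒜 j (mergeAt 𝒜 i'.succ a) j) := by
  funext l
  obtain ⟨i, hi⟩ := i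
  obtain ⟨j, hj⟩ := j
  obtain ⟨i', hi'⟩ := i'
  obtain ⟨l, hl⟩ := l
  obtain rfl : j = i := hij
  simp only [Fin.mk_le_mk] at h
  rcases lt_trichotomy l j with h1 | rfl | h1
  · have e1 : l < i' := by omega
    have e2 : l ≠ j := by omega
    have e3 : l < i' + 1 := by omega
    simp [mergeAt, h1, e1, e2, e3, sgn_sgn]
  · rcases h.lt_or_eq with h2 | rfl
    · have e1 : l < i' + 1 := by omega
      simp [mergeAt, h2, e1, sgn_mulI, sgn_sgn]
    · simp [mergeAt, sgn_mulI, sgn_sgn, mulI_assoc]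
  · have e1 : ¬ l < j := by omega
    have e2 : l ≠ j := by omega
    have e3 : ¬ l + 1 < j := by omega
    have e4 : l + 1 ≠ j := by omega
    rcases lt_trichotomy l i' with h2 | rfl | h2
    · have e5 : l + 1 < i' + 1 := by omega
      simp [mergeAt, e1, e2, e5, h2]
    · simp [mergeAt, e1, e2, e3, e4]
    · have e5 : ¬ l < i' := by omega
      have e6 : l ≠ i' := by omega
      simp [mergeAt, e1, e2, e3, e4, e5, e6]

theorem barDiff_tprod (n : ℕ) (a : Fin (n + 1) → augIdeal 𝒜) :
    barDiff 𝒜 n (PiTensorProduct.tprod k a) =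
      (-1 : k) • ∑ i : Fin n, PiTensorProduct.tprod k (mergeAt 𝒜 i a) := by
  rw [barDiff, LinearMap.smul_apply, PiTensorProduct.lift.tprod, sum_apply]
  rfl

theorem barDiff_comp_barDiff (n : ℕ) : barDiff 𝒜 n ∘ₗ barDiff 𝒜 (n + 1) = 0 := by
  refine PiTensorProduct.ext (MultilinearMap.ext fun a => ?_)
  simp only [LinearMap.compMultilinearMap_apply, LinearMap.comp_apply, barDiff_tprod, map_smul,
    map_sum, LinearMap.zero_apply, ← Finset.smul_sum]
  suffices h : ∑ i : Fin (n + 1), ∑ i' : Fin n,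
      PiTensorProduct.tprod k (mergeAt 𝒜 i' (mergeAt 𝒜 i a)) = 0 by
    rw [h, smul_zero, smul_zero]
  rw [← Fintype.sum_prod_type' (f := fun (i : Fin (n + 1)) (i' : Fin n) =>
    PiTensorProduct.tprod k (mergeAt 𝒜 i' (mergeAt 𝒜 i a)))]
  have key : ∀ (i : Fin (n + 1)) (j i' : Fin n), (j : ℕ) = i → j ≤ i' →
      PiTensorProduct.tprod k (mergeAt 𝒜 i' (mergeAt 𝒜 i a)) +
        PiTensorProduct.tprod k (mergeAt 𝒜 j (mergeAt 𝒜 i'.succ a)) = 0 := by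
    intro i j i' hij h
    rw [mergeAt_mergeAt 𝒜 a i j i' hij h, ← neg_one_smul k (mergeAt 𝒜 j _ j),
      MultilinearMap.map_update_smul, Function.update_eq_self]
    nth_rewrite 2 [← one_smul k (PiTensorProduct.tprod k (mergeAt 𝒜 j (mergeAt 𝒜 i'.succ a)))]
    rw [← add_smul, neg_add_cancel, zero_smul]
  -- The pair `(i, i')` with `i ≤ i'` is matched with `(i' + 1, i)`, the same two merges in the
  -- other order.
  refine Finset.sum_involution
    (fun (q : Fin (n + 1) × Fin n) _ => if h : (q.1 : ℕ) ≤ q.2 then (q.2.succ, ⟨q.1, h.trans_lt q.2.2⟩)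
      else (q.2.castSucc, ⟨q.1 - 1, by omega⟩)) ?_ ?_ (fun _ _ => Finset.mem_univ _) ?_
  · rintro ⟨i, i'⟩ -
    dsimp only
    split_ifs with h
    · exact key i ⟨i, _⟩ i' rfl h
    · rw [add_comm]
      have := key i'.castSucc i' ⟨i - 1, by omega⟩ rfl (by rw [Fin.le_def]; dsimp only; omega)
      have e : Fin.succ (⟨i - 1, by omega⟩ : Fin n) = i := by ext; simp; omega
      rwa [e] at this
  · rintro ⟨i, i'⟩ - -
    dsimp only
    split_ifs with h
    · simp [Fin.ext_iff]; omega
    · simp [Fin.ext_iff]; omega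
  · rintro ⟨i, i'⟩ -
    by_cases h : (i : ℕ) ≤ i'
    · have h2 : ¬ (i' : ℕ) + 1 ≤ i := by omega
      simp [h, h2]
    · have h2 : (i' : ℕ) ≤ i - 1 := by omega
      have h3 : (i : ℕ) - 1 + 1 = i := by omega
      simp [h, h2, h3]

end BarConstruction

/-! ## Monomials of the exterior Stanley–Reisner algebra -/

namespace StanleyReisner

open BarConstruction Permutohedral

variable (k : Type*) [CommRing k] {m : ℕ} (K : AbstractSimplicialComplex (Fin m))

theorem extMonomial_insert_of_lt {a : Fin m} {S : Finset (Fin m)} (h : ∀ b ∈ S, a < b) :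
    extMonomial k (insert a S) = gen k a * extMonomial k S := by
  have ha : a ∉ S := fun ha => lt_irrefl _ (h a ha)
  rw [extMonomial, Finset.sort_insert (r := (· ≤ ·)) (fun b hb => (h b hb).le) ha, List.map_cons, List.prod_cons]
  rfl

theorem gen_mul_gen (a b : Fin m) : gen k a * gen k b = -(gen k b * gen k a) :=
  eq_neg_of_add_eq_zero_left (ExteriorAlgebra.ι_add_mul_swap _ _)

/-- To reach its sorted place, `x_a` anticommutes past each smaller generator. -/
theorem gen_mul_extMonomial {a : Fin m} {S : Finset (Fin m)} (ha : a ∉ S) :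
    gen k a * extMonomial k S =
      (-1 : k) ^ (S.filter (· < a)).card • extMonomial k (insert a S) := by
  induction S using Finset.induction_on_min with
  | empty => simp [extMonomial]
  | insert t S ht ih =>
    have htS : t ∉ S := fun h => lt_irrefl _ (ht t h)
    rw [Finset.mem_insert, not_or] at ha
    rcases lt_or_gt_of_ne ha.1 with hlt | hgt
    · have h1 : ∀ b ∈ insert t S, a < b := by
        intro b hb
        rcases Finset.mem_insert.1 hb with rfl | hb
        exacts [hlt, hlt.trans (ht b hb)]
      rw [Finset.filter_eq_empty_iff.2 fun b hb => (h1 b hb).not_gt, Finset.card_empty, pow_zero,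
        one_smul, extMonomial_insert_of_lt k h1]
    · have h1 : ∀ b ∈ insert a S, t < b := by
        intro b hb
        rcases Finset.mem_insert.1 hb with rfl | hb
        exacts [hgt, ht b hb]
      rw [extMonomial_insert_of_lt k ht, ← mul_assoc, gen_mul_gen, neg_mul, mul_assoc, ih ha.2,
        Finset.insert_comm, extMonomial_insert_of_lt k h1, Finset.filter_insert, if_pos hgt,
        Finset.card_insert_of_notMem (by simp [htS]), pow_succ, mul_smul_comm, mul_neg_one, neg_smul]

theorem extMonomial_mul {S T : Finset (Fin m)} (h : Disjoint S T) :
    extMonomial k S * extMonomial k T = ((shuff S T : ℤ) : k) • extMonomial k (S ∪ T) := by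
  induction S using Finset.induction_on_min with
  | empty => simp [extMonomial, shuff]
  | insert s S hs ih =>
    rw [Finset.disjoint_insert_left] at h
    have hsS : s ∉ S := fun h => lt_irrefl _ (hs s h)
    rw [extMonomial_insert_of_lt k hs, mul_assoc, ih h.2, mul_smul_comm,
      gen_mul_extMonomial k (by simp [h.1, hsS]), smul_smul, Finset.insert_union]
    congr 1
    have e1 : (S ∪ T).filter (· < s) = T.filter (· < s) := by
      rw [Finset.filter_union, Finset.filter_eq_empty_iff.2 fun b hb => (hs b hb).not_gt,
        Finset.empty_union]
    have e2 : ((insert s S ×ˢ T).filter fun q => q.2 < q.1).card =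
        ((S ×ˢ T).filter fun q => q.2 < q.1).card + (T.filter (· < s)).card := by
      rw [Finset.insert_eq, Finset.union_product, Finset.filter_union,
        Finset.card_union_of_disjoint, add_comm, Finset.singleton_product, Finset.filter_map,
        Finset.card_map]
      · rfl
      · rw [Finset.disjoint_left]
        rintro ⟨a, b⟩ h1 h2
        simp only [Finset.mem_filter, Finset.mem_product, Finset.mem_singleton] at h1 h2
        exact hsS (h1.1.1 ▸ h2.1.1)
    rw [e1, shuff, shuff, e2, pow_add]
    push_cast
    rfl

theorem extMonomial_eq_ιMulti {n : ℕ} (T : Finset (Fin m)) (h : T.card = n) :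
    extMonomial k T =
      ExteriorAlgebra.ιMulti k n fun i => (Pi.single (T.orderEmbOfFin h i) 1 : Fin m → k) := by
  rw [ExteriorAlgebra.ιMulti_apply, extMonomial]
  congr 1
  apply List.ext_getElem
  · simp [h]
  · intro i h1 h2
    simp [gen, Finset.orderEmbOfFin_apply]

/-! ### Coefficient functionals and independence of monomials. -/

/-- The coefficient of `x_S`, a linear functional on the exterior algebra. -/
noncomputable def extCoeff (S : Finset (Fin m)) : ExteriorAlgebra k (Fin m → k) →ₗ[k] k :=
  ExteriorAlgebra.liftAlternating (R := k) (Pi.single S.card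
    (Matrix.detRowAlternating.compLinearMap (LinearMap.funLeft k k (S.orderEmbOfFin rfl))))

/-- The value is the minor with rows the unit vectors of `T` and columns `S`: the identity matrix if
`S = T`, while an element of `T \ S` gives a zero row. -/
theorem extCoeff_extMonomial (S T : Finset (Fin m)) :
    extCoeff k S (extMonomial k T) = if S = T then 1 else 0 := by
  by_cases hc : T.card = S.card
  · rw [extMonomial_eq_ιMulti k T hc, extCoeff, ExteriorAlgebra.liftAlternating_apply_ιMulti,
      Pi.single_eq_same, AlternatingMap.compLinearMap_apply]
    change Matrix.det _ = _
    split_ifs with h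
    · subst h
      rw [← Matrix.det_one (n := Fin S.card)]
      congr 1
      ext i j
      simp [LinearMap.funLeft_apply, Matrix.one_apply, Pi.single_apply, eq_comm]
    · have : ¬ T ⊆ S := fun h' => h (Finset.eq_of_subset_of_card_le h' hc.ge).symm
      obtain ⟨t, ht, htS⟩ := Finset.not_subset.1 this
      obtain ⟨i, hi⟩ : ∃ i, T.orderEmbOfFin hc i = t := by
        have : t ∈ Set.range (T.orderEmbOfFin hc) := by rwa [Finset.range_orderEmbOfFin]
        exact this
      refine Matrix.det_eq_zero_of_row_eq_zero i fun j => ?_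
      simp only [LinearMap.funLeft_apply, hi]
      refine Pi.single_eq_of_ne (fun h' => htS ?_) _
      rw [← h']
      exact Finset.orderEmbOfFin_mem _ _ _
  · rw [extMonomial_eq_ιMulti k T rfl, extCoeff, ExteriorAlgebra.liftAlternating_apply_ιMulti,
      Pi.single_eq_of_ne hc, if_neg fun h => hc (by rw [h])]
    rfl

/-- The projection of `k^m` to the coordinates in `S`. -/
def coordProj (S : Finset (Fin m)) : (Fin m → k) →ₗ[k] (Fin m → k) where
  toFun v i := if i ∈ S then v i else 0
  map_add' v w := by ext i; simp only [Pi.add_apply]; split_ifs <;> simp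
  map_smul' c v := by ext i; simp

/-- Setting the generators outside `S` to zero is an algebra map. For `S ∈ K` it kills every
relation, because no set outside `K` can be a nonempty subset of `S`. Thus it descends to `Λ[K]`,
and `extCoeff` can be applied afterwards. -/
theorem map_coordProj_extMonomial (S T : Finset (Fin m)) :
    ExteriorAlgebra.map (coordProj k S) (extMonomial k T) =
      if T ⊆ S then extMonomial k T else 0 := by
  have h1 : ∀ t, coordProj k S (Pi.single t 1) = if t ∈ S then Pi.single t 1 else 0 := by
    intro t
    ext i
    by_cases hi : i = t
    · subst hi; by_cases h : i ∈ S <;> simp [coordProj, h]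
    · by_cases h : t ∈ S <;> simp [coordProj, h, hi]
  rw [extMonomial_eq_ιMulti k T rfl, ExteriorAlgebra.map_apply_ιMulti]
  split_ifs with h
  · congr 1
    funext i
    rw [Function.comp_apply, h1, if_pos (h (Finset.orderEmbOfFin_mem _ _ _))]
  · obtain ⟨t, ht, htS⟩ := Finset.not_subset.1 h
    obtain ⟨i, hi⟩ : ∃ i, T.orderEmbOfFin rfl i = t := by
      have : t ∈ Set.range (T.orderEmbOfFin rfl) := by rwa [Finset.range_orderEmbOfFin]
      exact this
    refine AlternatingMap.map_coord_zero _ i ?_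
    rw [Function.comp_apply, h1, hi, if_neg htS]

/-- The coefficient of `x_S`, `S ∈ K`, a linear functional on `Λ[K]`. -/
noncomputable def coeff {S : Finset (Fin m)} (hS : S ∈ K.faces) : ExtSR k K →ₗ[k] k :=
  extCoeff k S ∘ₗ (RingQuot.liftAlgHom k ⟨ExteriorAlgebra.map (coordProj k S), by
    rintro _ _ ⟨T, hT, hK⟩
    rw [map_coordProj_extMonomial, if_neg fun h => hK ((K.isRelLowerSet_faces hS).2 h hT),
      map_zero]⟩ : ExtSR k K →ₐ[k] ExteriorAlgebra k (Fin m → k)).toLinearMap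

theorem coeff_monomial {S : Finset (Fin m)} (hS : S ∈ K.faces) {T : Finset (Fin m)}
    (hT : T.Nonempty) :
    coeff k K hS (monomial k K T hT : ExtSR k K) = if S = T then 1 else 0 := by
  change extCoeff k S (RingQuot.liftAlgHom k _ (RingQuot.mkAlgHom k _ _)) = _
  rw [RingQuot.liftAlgHom_mkAlgHom_apply, map_coordProj_extMonomial]
  split_ifs with h1 h2 h2
  · rw [extCoeff_extMonomial, if_pos h2]
  · rw [extCoeff_extMonomial, if_neg h2]
  · exact absurd h2.ge h1
  · rw [map_zero]

theorem monomial_eq_zero {S : Finset (Fin m)} (hS : S.Nonempty) (hK : S ∉ K.faces) :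
    monomial k K S hS = 0 := by
  refine Subtype.ext ?_
  have : proj k K (extMonomial k S) = proj k K 0 := RingQuot.mkAlgHom_rel k (Rel.of S hS hK)
  rwa [map_zero] at this

theorem sgn_monomial {S : Finset (Fin m)} (hS : S.Nonempty) :
    sgn (gr k K) (monomial k K S hS) = (((-1) ^ (S.card + 1) : ℤ) : k) • monomial k K S hS := by
  refine Subtype.ext ?_
  have := sgnMap_of_mem (gr k K) (a := proj k K (extMonomial k S)) ⟨_, extMonomial_mem k S, rfl⟩
  push_cast
  exact this

theorem mulI_monomial {S T : Finset (Fin m)} (hS : S.Nonempty) (hT : T.Nonempty)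
    (h : Disjoint S T) :
    mulI (gr k K) (monomial k K S hS) (monomial k K T hT) =
      ((shuff S T : ℤ) : k) • monomial k K (S ∪ T) (hS.inl) := by
  refine Subtype.ext ?_
  change proj k K _ * proj k K _ = _ • proj k K _
  rw [← map_mul, extMonomial_mul k h, map_smul]

/-! ## The multidegree `(1, …, 1)` component of the bar construction -/

theorem barMonomial_eq_zero {n : ℕ} (U : OrderedPartition m n) (hU : ¬ U.IsIn K) :
    barMonomial k K U.part U.nonempty = 0 := by
  simp only [OrderedPartition.IsIn, not_forall] at hU
  obtain ⟨j, hj⟩ := hU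
  exact MultilinearMap.map_coord_zero _ j (monomial_eq_zero k K _ hj)

/-- The coefficient of `[x_{U_1} | ⋯ | x_{U_n}]`, a linear functional on the bar construction. -/
noncomputable def barCoeff {n : ℕ} {U : OrderedPartition m n} (hU : U.IsIn K) :
    Bar (gr k K) n →ₗ[k] k :=
  PiTensorProduct.lift ((MultilinearMap.mkPiAlgebra k (Fin n) k).compLinearMap
    fun j => coeff k K (hU j) ∘ₗ (augIdeal (gr k K)).subtype)

open scoped Classical in
theorem barCoeff_barMonomial {n : ℕ} {U : OrderedPartition m n} (hU : U.IsIn K)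
    (W : OrderedPartition m n) :
    barCoeff k K hU (barMonomial k K W.part W.nonempty) = if U = W then 1 else 0 := by
  rw [barCoeff, barMonomial, PiTensorProduct.lift.tprod, MultilinearMap.compLinearMap_apply,
    MultilinearMap.mkPiAlgebra_apply]
  simp only [LinearMap.comp_apply, Submodule.subtype_apply, coeff_monomial]
  split_ifs with h
  · subst h; simp
  · have : ∃ j, U.part j ≠ W.part j := by
      by_contra! h'
      exact h (OrderedPartition.ext (funext h'))
    obtain ⟨j, hj⟩ := this
    exact Finset.prod_eq_zero (Finset.mem_univ j) (if_neg hj)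

theorem sum_mdeg_part {n : ℕ} (U : OrderedPartition m n) : ∑ j, mdeg (U.part j) = 1 := by
  funext a
  simp [Finset.sum_apply, mdeg, U.mem_part]

/-- Total multidegree `1` at `a` says that exactly one of the sets contains `a`. -/
theorem exists_orderedPartition {n : ℕ} (S : Fin n → Finset (Fin m)) (hS : ∀ j, (S j).Nonempty)
    (h : ∑ j, mdeg (S j) = 1) : ∃ U : OrderedPartition m n, U.part = S := by
  have h' : ∀ a, (Finset.univ.filter fun j => a ∈ S j).card = 1 := fun a => by
    have := congrFun h a
    simpa [Finset.sum_apply, mdeg] using this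
  refine ⟨⟨S, hS, fun i j hij => ?_, fun a => ?_⟩, rfl⟩
  · rw [Finset.disjoint_left]
    intro a hi hj
    exact hij (Finset.card_le_one.1 (h' a).le i (by simpa using hi) j (by simpa using hj))
  · obtain ⟨j, hj⟩ := Finset.card_pos.1 ((h' a).symm ▸ Nat.one_pos)
    exact ⟨j, by simpa using hj⟩

theorem barComponent_one_eq_span (n : ℕ) :
    barComponent k K n 1 = Submodule.span k
      (Set.range fun U : {U : OrderedPartition m n // U.IsIn K} =>
        barMonomial k K U.1.part U.1.nonempty) := by
  refine le_antisymm (Submodule.span_le.2 ?_) (Submodule.span_mono ?_)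
  · rintro _ ⟨S, hS, h, rfl⟩
    obtain ⟨U, rfl⟩ := exists_orderedPartition S hS h
    by_cases hU : U.IsIn K
    · exact Submodule.subset_span ⟨⟨U, hU⟩, rfl⟩
    · have := barMonomial_eq_zero k K U hU
      rw [this]
      exact zero_mem _
  · rintro _ ⟨U, rfl⟩
    exact ⟨_, _, sum_mdeg_part U.1, rfl⟩

theorem barComponent_eq_bot {n : ℕ} (h : m < n) : barComponent k K n 1 = ⊥ := by
  rw [barComponent_one_eq_span, Submodule.span_eq_bot]
  rintro _ ⟨U, rfl⟩
  exact absurd U.1.card_le (not_le.2 h)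

theorem barMonomial_mem_barComponent {n : ℕ} (U : OrderedPartition m n) :
    barMonomial k K U.part U.nonempty ∈ barComponent k K n 1 :=
  Submodule.subset_span ⟨_, _, sum_mdeg_part U, rfl⟩

open scoped Classical in
/-- The multidegree `(1, …, 1)` component is free on the bar monomials of ordered partitions into
simplices. -/
noncomputable def barEquiv (n : ℕ) :
    ({U : OrderedPartition m n // U.IsIn K} → k) ≃ₗ[k] barComponent k K n 1 :=
  LinearEquiv.ofLinearMap
    ((Fintype.linearCombination k fun U : {U : OrderedPartition m n // U.IsIn K} =>
      barMonomial k K U.1.part U.1.nonempty).codRestrict _ fun c => by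
        rw [Fintype.linearCombination_apply]
        exact Submodule.sum_mem _ fun U _ =>
          Submodule.smul_mem _ _ (barMonomial_mem_barComponent k K U.1))
    (LinearMap.pi fun U => barCoeff k K U.2 ∘ₗ (barComponent k K n 1).subtype)
    (by
      refine LinearMap.ext fun t => Subtype.ext ?_
      have hU : ∀ t ∈ barComponent k K n 1, Fintype.linearCombination k
          (fun U : {U : OrderedPartition m n // U.IsIn K} =>
            barMonomial k K U.1.part U.1.nonempty) (fun U => barCoeff k K U.2 t) = t := by
        rw [barComponent_one_eq_span]
        refine LinearMap.eqOn_span (f := Fintype.linearCombination k _ ∘ₗ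
          LinearMap.pi fun U => barCoeff k K U.2) (g := LinearMap.id) ?_
        rintro _ ⟨W, rfl⟩
        simp only [LinearMap.comp_apply, Fintype.linearCombination_apply, LinearMap.pi_apply,
          barCoeff_barMonomial, LinearMap.id_apply, ite_smul, one_smul, zero_smul]
        rw [Finset.sum_eq_single W (fun U _ hUW => if_neg fun h => hUW (Subtype.ext h))
          (fun h => absurd (Finset.mem_univ _) h), if_pos rfl]
      exact hU t.1 t.2)
    (by
      refine LinearMap.ext fun c => funext fun U => ?_
      change barCoeff k K U.2 (Fintype.linearCombination k _ c) = c U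
      simp only [Fintype.linearCombination_apply, map_sum, map_smul, barCoeff_barMonomial]
      rw [Finset.sum_eq_single U (fun W _ hUW => by
        rw [if_neg fun h => hUW (Subtype.ext h).symm, smul_zero])
          (fun h => absurd (Finset.mem_univ _) h), if_pos rfl, smul_eq_mul, mul_one])

open scoped Classical in
theorem coe_barEquiv {n : ℕ} (c : {U : OrderedPartition m n // U.IsIn K} → k) :
    (barEquiv k K n c : Bar (gr k K) n) =
      ∑ U : {U : OrderedPartition m n // U.IsIn K},
        c U • barMonomial k K U.1.part U.1.nonempty := rfl

theorem barDiff_barMonomial {n : ℕ} (W : OrderedPartition m (n + 1)) :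
    barDiff (gr k K) n (barMonomial k K W.part W.nonempty) =
      ∑ i : Fin n, ((milgramSign (W.merge i) i (W.part i.castSucc) : ℤ) : k) •
        barMonomial k K (W.merge i).part (W.merge i).nonempty := by
  rw [barMonomial, barDiff_tprod, Finset.smul_sum]
  refine Finset.sum_congr rfl fun i _ => ?_
  have hsucc : (W.merge i).part i \ W.part i.castSucc = W.part i.succ := by
    conv_rhs => rw [← W.split_merge i]
    rw [OrderedPartition.part_split_succ]
  have hdisj : Disjoint (W.part i.castSucc) (W.part i.succ) :=
    W.disjoint _ _ (by simp [Fin.ext_iff])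
  -- The sign contributed by each slot. The `+ 1` in the exponent of the merged slot makes the
  -- product the negative of the Milgram sign, compensating the minus in front of the differential.
  let c : Fin n → ℤ := fun l => if l < i then (-1) ^ (((W.merge i).part l).card + 1)
    else if l = i then (-1) ^ ((W.part i.castSucc).card + 1) *
      shuff (W.part i.castSucc) (W.part i.succ) else 1
  have hc : ∏ l, c l = -milgramSign (W.merge i) i (W.part i.castSucc) := by
    have h1 : ∏ l, c l = (∏ l ∈ Finset.univ.filter (· < i), (-1) ^ (((W.merge i).part l).card - 1)) *
        ((-1) ^ ((W.part i.castSucc).card + 1) * shuff (W.part i.castSucc) (W.part i.succ)) := by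
      rw [Finset.prod_ite, Finset.prod_ite_eq', if_pos (by simp)]
      congr 1
      refine Finset.prod_congr rfl fun l _ => ?_
      obtain ⟨d, hd⟩ := Nat.exists_eq_succ_of_ne_zero ((W.merge i).nonempty l).card_pos.ne'
      rw [hd, Nat.succ_eq_add_one, Nat.add_sub_cancel, add_assoc, pow_add]
      norm_num
    rw [h1, Finset.prod_pow_eq_pow_sum, milgramSign, hsucc]
    ring
  have hm : mergeAt (gr k K) i (fun j => monomial k K (W.part j) (W.nonempty j)) =
      fun l => ((c l : ℤ) : k) • monomial k K ((W.merge i).part l) ((W.merge i).nonempty l) := by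
    funext l
    have hp := W.part_merge i l
    have hcongr : ∀ {S T : Finset (Fin m)} (hS : S.Nonempty) (hT : T.Nonempty), S = T →
        monomial k K S hS = monomial k K T hT := by
      rintro S _ hS hT rfl
      rfl
    simp only [mergeAt, c]
    split_ifs at hp ⊢ with h1 h2
    · rw [sgn_monomial, hcongr _ (W.nonempty l.castSucc) hp, hp]
    · rw [sgn_monomial, map_smul, LinearMap.smul_apply, mulI_monomial k K _ _ hdisj, smul_smul,
        ← hcongr ((W.merge i).nonempty l) _ hp, Int.cast_mul]
    · rw [Int.cast_one, one_smul, ← hcongr ((W.merge i).nonempty l) _ hp]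
  rw [hm, MultilinearMap.map_smul_univ, ← Int.cast_prod, hc, Int.cast_neg, smul_smul, neg_one_mul,
    neg_neg]
  rfl

theorem barDiff_mem_barComponent (n : ℕ) {t : Bar (gr k K) (n + 1)}
    (ht : t ∈ barComponent k K (n + 1) 1) : barDiff (gr k K) n t ∈ barComponent k K n 1 := by
  revert t
  change barComponent k K (n + 1) 1 ≤ (barComponent k K n 1).comap (barDiff (gr k K) n)
  refine Submodule.span_le.2 ?_
  rintro _ ⟨S, hS, h, rfl⟩
  obtain ⟨W, rfl⟩ := exists_orderedPartition S hS h
  change barDiff (gr k K) n (barMonomial k K W.part W.nonempty) ∈ barComponent k K n 1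
  rw [barDiff_barMonomial]
  exact Submodule.sum_mem _ fun i _ =>
    Submodule.smul_mem _ _ (barMonomial_mem_barComponent k K _)

end StanleyReisner

/-! ## The faces of the permutohedron -/

namespace Permutohedral

open Polytopal

namespace OrderedPartition

variable {m n : ℕ}

/-- The permutations whose vertices span the face of an ordered partition. -/
def Compat (U : OrderedPartition m n) (σ : Equiv.Perm (Fin m)) : Prop :=
  ∀ a b, U.idx a < U.idx b → σ a < σ b

theorem face_eq (U : OrderedPartition m n) :
    face U = convexHull ℝ {v | ∃ σ, v = vertex σ ∧ U.Compat σ} := by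
  unfold face
  congr 1
  ext v
  refine exists_congr fun σ => and_congr_right fun _ => ⟨fun h a b hab => ?_, fun h i j hij a ha b hb => ?_⟩
  · exact h _ _ hab a (U.mem_part_idx a) b (U.mem_part_idx b)
  · exact h a b (by rwa [U.mem_part.1 ha, U.mem_part.1 hb])

theorem Compat.vertex_mem {U : OrderedPartition m n} {σ : Equiv.Perm (Fin m)} (h : U.Compat σ) :
    vertex σ ∈ face U := by
  rw [face_eq]
  exact subset_convexHull _ _ ⟨σ, rfl, h⟩

theorem face_subset_of_convex {U : OrderedPartition m n} {S : Set (Fin m → ℝ)} (hS : Convex ℝ S)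
    (h : ∀ σ, U.Compat σ → vertex σ ∈ S) : face U ⊆ S := by
  rw [face_eq]
  refine convexHull_min ?_ hS
  rintro _ ⟨σ, rfl, hσ⟩
  exact h σ hσ

/-- An open half-space is convex, so a strict inequality between coordinates passes from the
vertices to their hull. Hence no further vertex of the permutohedron lies on the face. -/
theorem lt_of_mem_face {U : OrderedPartition m n} {x : Fin m → ℝ} (hx : x ∈ face U) {a b : Fin m}
    (hab : U.idx a < U.idx b) : x a < x b := by
  have hlin : IsLinearMap ℝ fun x : Fin m → ℝ => x a - x b :=
    ⟨fun x y => by simp only [Pi.add_apply]; ring, fun c x => by simp [mul_sub]⟩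
  have h : face U ⊆ {x | x a - x b < 0} :=
    face_subset_of_convex (convex_halfSpace_lt hlin 0) fun σ hσ => by
      have := hσ a b hab
      simp only [vertex, Set.mem_ofPred_eq, sub_neg, add_lt_add_iff_right, Nat.cast_lt]
      exact this
  exact sub_neg.1 (h hx)

theorem compat_of_vertex_mem {U : OrderedPartition m n} {σ : Equiv.Perm (Fin m)}
    (h : vertex σ ∈ face U) : U.Compat σ := fun a b hab => by
  have := lt_of_mem_face h hab
  simpa [vertex] using this

theorem exists_compat (U : OrderedPartition m n) : ∃ σ, U.Compat σ := by
  refine ⟨(Tuple.sort U.idx).symm, fun a b hab => ?_⟩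
  by_contra! h
  have := Tuple.monotone_sort U.idx h
  simp only [Function.comp_apply, Equiv.apply_symm_apply] at this
  exact absurd hab (not_lt.2 this)

theorem Compat.mul_swap {U : OrderedPartition m n} {σ : Equiv.Perm (Fin m)} (h : U.Compat σ)
    {a b : Fin m} (hab : U.idx a = U.idx b) : U.Compat (σ * Equiv.swap a b) := by
  have key : ∀ c, U.idx (Equiv.swap a b c) = U.idx c := fun c => by
    rw [Equiv.swap_apply_def]
    split_ifs with h1 h2 <;> simp [*]
  intro c d hcd
  exact h _ _ (by rwa [key, key])

/-- If `a` and `b` shared a part of `W`, swapping their values would stay in `face W`, so both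
orders would occur there; but `face U` allows only one. -/
theorem face_subset_face_iff {n' : ℕ} {W : OrderedPartition m n'} {U : OrderedPartition m n} :
    face W ⊆ face U ↔ ∀ a b, U.idx a < U.idx b → W.idx a < W.idx b := by
  constructor
  · intro h a b hab
    obtain ⟨σ, hσ⟩ := W.exists_compat
    have h1 := compat_of_vertex_mem (h hσ.vertex_mem) a b hab
    rcases lt_trichotomy (W.idx a) (W.idx b) with h2 | h2 | h2
    · exact h2
    · have := compat_of_vertex_mem (h (hσ.mul_swap h2).vertex_mem) a b hab
      simp only [Equiv.Perm.mul_apply, Equiv.swap_apply_left, Equiv.swap_apply_right] at this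
      exact absurd this h1.not_gt
    · exact absurd (hσ _ _ h2) h1.not_gt
  · intro h
    exact face_subset_of_convex (by rw [face_eq]; exact convex_convexHull ℝ _) fun σ hσ =>
      Compat.vertex_mem fun a b hab => hσ _ _ (h a b hab)

theorem face_injective : Function.Injective (face : OrderedPartition m n → _) := fun _ _ h =>
  eq_of_idx_lt fun a b =>
    ⟨face_subset_face_iff.1 h.ge a b, face_subset_face_iff.1 h.le a b⟩

/-- All compatible permutations send `U_j` onto the same set of values, by uniqueness of the
monotone rearrangement. The freedom in `f` is used with a truncated function in
`sum_le_sum_of_mem_face`. -/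
theorem sum_part_compat (U : OrderedPartition m n) {σ τ : Equiv.Perm (Fin m)} (hσ : U.Compat σ)
    (hτ : U.Compat τ) (j : Fin n) (f : Fin m → ℝ) :
    ∑ a ∈ U.part j, f (σ a) = ∑ a ∈ U.part j, f (τ a) := by
  have hmono : ∀ {σ : Equiv.Perm (Fin m)}, U.Compat σ → Monotone (U.idx ∘ ⇑σ.symm) := by
    intro σ hσ i i' hi
    by_contra! h
    have := hσ _ _ h
    simp only [Equiv.apply_symm_apply] at this
    exact absurd hi this.not_ge
  have heq := Tuple.unique_monotone (hmono hσ) (hmono hτ)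
  refine Finset.sum_equiv (σ.trans τ.symm) (fun a => ?_) (fun a _ => by simp)
  have := congrFun heq (σ a)
  simp only [Function.comp_apply, Equiv.symm_apply_apply] at this
  rw [mem_part, mem_part, this]
  rfl

/-! ### Direction spaces and dimensions of the faces. -/

/-- The sums of the coordinates over the parts. -/
def partSum (U : OrderedPartition m n) : (Fin m → ℝ) →ₗ[ℝ] (Fin n → ℝ) :=
  LinearMap.pi fun j => ∑ a ∈ U.part j, LinearMap.proj a

theorem partSum_apply (U : OrderedPartition m n) (x : Fin m → ℝ) (j : Fin n) :
    U.partSum x j = ∑ a ∈ U.part j, x a := by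
  simp [partSum]

theorem vertex_sub_vertex_swap (σ : Equiv.Perm (Fin m)) (a b : Fin m) :
    vertex σ - vertex (σ * Equiv.swap a b) =
      (((σ a : ℕ) : ℝ) - ((σ b : ℕ) : ℝ)) • (Pi.single a 1 - Pi.single b 1 : Fin m → ℝ) := by
  ext c
  simp only [vertex, Pi.sub_apply, Equiv.Perm.mul_apply, Pi.smul_apply, smul_eq_mul, Pi.single_apply,
    Equiv.swap_apply_def]
  split_ifs <;> simp_all

/-- The vectors `e_a - e_b` with `a`, `b` in the same part are parallel to the face. -/
theorem single_sub_single_mem (U : OrderedPartition m n) {a b : Fin m} (hab : U.idx a = U.idx b) :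
    (Pi.single a 1 - Pi.single b 1 : Fin m → ℝ) ∈ vectorSpan ℝ (face U) := by
  rcases eq_or_ne a b with rfl | hne
  · rw [sub_self]; exact zero_mem _
  obtain ⟨σ, hσ⟩ := U.exists_compat
  have h := vsub_mem_vectorSpan ℝ hσ.vertex_mem (hσ.mul_swap hab).vertex_mem
  rw [vsub_eq_sub, vertex_sub_vertex_swap] at h
  refine (Submodule.smul_mem_iff _ ?_).1 h
  rw [sub_ne_zero, Nat.cast_injective.ne_iff]
  exact fun h' => hne (σ.injective (Fin.ext h'))

theorem vectorSpan_face (U : OrderedPartition m n) :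
    vectorSpan ℝ (face U) = LinearMap.ker U.partSum := by
  apply le_antisymm
  · have h : vectorSpan ℝ (face U) = vectorSpan ℝ {v | ∃ σ, v = vertex σ ∧ U.Compat σ} := by
      rw [face_eq, ← direction_affineSpan, affineSpan_convexHull, direction_affineSpan]
    rw [h, vectorSpan_def, Submodule.span_le]
    rintro _ ⟨_, ⟨σ, rfl, hσ⟩, _, ⟨τ, rfl, hτ⟩, rfl⟩
    rw [SetLike.mem_coe, LinearMap.mem_ker]
    funext j
    rw [partSum_apply, Pi.zero_apply]
    simp only [vsub_eq_sub, Pi.sub_apply, Finset.sum_sub_distrib]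
    exact sub_eq_zero.2 (U.sum_part_compat hσ hτ j fun i => ((i : ℕ) : ℝ) + 1)
  · intro w hw
    choose r hr using U.idx_surjective
    have hw' : ∀ j, ∑ a ∈ U.part j, w a = 0 := fun j => by
      rw [← partSum_apply, LinearMap.mem_ker.1 hw]; rfl
    have h1 : ∑ a, w a • (Pi.single (r (U.idx a)) 1 : Fin m → ℝ) = 0 := by
      rw [← Finset.sum_fiberwise Finset.univ U.idx]
      refine Finset.sum_eq_zero fun j _ => ?_
      rw [← part_eq_filter, Finset.sum_congr rfl fun a ha => by rw [U.mem_part.1 ha],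
        ← Finset.sum_smul, hw', zero_smul]
    -- Subtracting a chosen representative in each part costs nothing, since the coordinates of `w`
    -- sum to zero there.
    have h2 : w = ∑ a, w a • (Pi.single a 1 - Pi.single (r (U.idx a)) 1 : Fin m → ℝ) := by
      simp only [smul_sub, Finset.sum_sub_distrib, h1, sub_zero]
      exact pi_eq_sum_univ' w
    rw [h2]
    exact Submodule.sum_mem _ fun a _ =>
      Submodule.smul_mem _ _ (U.single_sub_single_mem (hr _).symm)

theorem finrank_face_add (U : OrderedPartition m n) :
    Module.finrank ℝ (vectorSpan ℝ (face U)) + n = m := by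
  have hsurj : Function.Surjective U.partSum := by
    intro c
    choose r hr using U.idx_surjective
    refine ⟨fun a => if a = r (U.idx a) then c (U.idx a) else 0, funext fun j => ?_⟩
    rw [partSum_apply, Finset.sum_eq_single (r j)]
    · rw [hr, if_pos rfl]
    · intro a ha hne
      rw [U.mem_part.1 ha, if_neg hne]
    · intro h
      exact absurd (U.mem_part.2 (hr j)) h
  have := LinearMap.finrank_range_add_finrank_ker U.partSum
  rw [LinearMap.range_eq_top.2 hsurj, finrank_top, Module.finrank_fin_fun, Module.finrank_fin_fun] at this
  rw [vectorSpan_face]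
  omega

/-- On a face of `face U` that splits the part `U_j` into `M` and `U_j \ M`, the sum of the
coordinates in `M` is minimal. -/
theorem sum_le_sum_of_mem_face {U : OrderedPartition m n} (s : U.Splitting) {x y : Fin m → ℝ}
    (hx : x ∈ face s.apply) (hy : y ∈ face U) : ∑ a ∈ s.2.1, x a ≤ ∑ a ∈ s.2.1, y a := by
  have hvert : ∀ σ τ, s.apply.Compat σ → U.Compat τ →
      ∑ a ∈ s.2.1, vertex σ a ≤ ∑ a ∈ s.2.1, vertex τ a := by
    intro σ τ hσ hτ
    have hσU : U.Compat σ := fun a b hab => hσ a b (idx_split_lt s hab)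
    obtain ⟨t, htM, ht⟩ := s.2.1.exists_max_image σ s.2.2.1
    -- Truncation at the largest value of `σ` on `M`. For `σ` it changes nothing on `M` and gives
    -- zero on `U_j \ M`, so the sum over `M` is the sum over `U_j`, which is the same for `τ`. For
    -- `τ`, dropping the nonpositive terms outside `M` and undoing the truncation can only increase
    -- the sum.
    let f : Fin m → ℝ := fun i => min (((i : ℕ) : ℝ) - ((σ t : ℕ) : ℝ)) 0
    have h1 : ∑ a ∈ s.2.1, f (σ a) = ∑ a ∈ U.part s.1, f (σ a) := by
      refine Finset.sum_subset s.2.2.2.1 fun b hb hbM => min_eq_right ?_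
      rw [sub_nonneg, Nat.cast_le]
      refine (hσ t b ?_).le
      have e1 := s.idx_apply t
      have e2 := s.idx_apply b
      have e3 := s.idx_eq htM
      have e4 := U.mem_part.1 hb
      rw [if_neg (by rw [Fin.lt_def]; omega), if_pos htM] at e1
      rw [if_neg (by rw [Fin.lt_def]; omega), if_neg hbM] at e2
      rw [Fin.lt_def]
      omega
    have h2 : ∑ a ∈ U.part s.1, f (τ a) ≤ ∑ a ∈ s.2.1, f (τ a) :=
    by
      rw [← neg_le_neg_iff, ← Finset.sum_neg_distrib, ← Finset.sum_neg_distrib]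
      exact Finset.sum_le_sum_of_subset_of_nonneg s.2.2.2.1 fun _ _ _ =>
        neg_nonneg.2 (min_le_right _ _)
    have h3 : ∑ a ∈ s.2.1, (((σ a : ℕ) : ℝ) - ((σ t : ℕ) : ℝ)) = ∑ a ∈ s.2.1, f (σ a) :=
      Finset.sum_congr rfl fun a ha =>
        (min_eq_left (by rw [sub_nonpos, Nat.cast_le]; exact ht a ha)).symm
    have h4 : ∑ a ∈ s.2.1, f (τ a) ≤ ∑ a ∈ s.2.1, (((τ a : ℕ) : ℝ) - ((σ t : ℕ) : ℝ)) :=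
      Finset.sum_le_sum fun a _ => min_le_left _ _
    have h5 := h3.trans_le (h1.trans_le ((U.sum_part_compat hσU hτ s.1 f).trans_le (h2.trans h4)))
    rw [Finset.sum_sub_distrib, Finset.sum_sub_distrib, sub_le_sub_iff_right] at h5
    simp only [vertex, Finset.sum_add_distrib]
    gcongr
  have hlin : IsLinearMap ℝ fun x : Fin m → ℝ => ∑ a ∈ s.2.1, x a :=
    ⟨fun x y => by simp [Finset.sum_add_distrib], fun c x => by simp [Finset.mul_sum]⟩
  have h1 : face s.apply ⊆ {x | ∑ a ∈ s.2.1, x a ≤ ∑ a ∈ s.2.1, y a} :=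
    face_subset_of_convex (convex_halfSpace_le hlin _) fun σ hσ => by
      have h2 : face U ⊆ {y | ∑ a ∈ s.2.1, vertex σ a ≤ ∑ a ∈ s.2.1, y a} :=
        face_subset_of_convex (convex_halfSpace_ge hlin _) fun τ hτ => hvert σ τ hσ hτ
      exact h2 hy
  exact h1 hx

end OrderedPartition

/-! ### The cells of the permutohedral complex -/

section Cells

variable {m : ℕ} {K : AbstractSimplicialComplex (Fin m)}

theorem exists_orderedPartition_of_cell {p : ℕ} (F : Cell (permComplex K) p) :
    ∃ (n : ℕ) (_ : p + n = m) (U : OrderedPartition m n), U.IsIn K ∧ F.1 = face U := by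
  obtain ⟨F, ⟨n, U, hU, rfl⟩, hp⟩ := F
  exact ⟨n, by rw [← hp, U.finrank_face_add], U, hU, rfl⟩

/-- The cell of an ordered partition into simplices. -/
def cell {p n : ℕ} (h : p + n = m) (U : OrderedPartition m n) (hU : U.IsIn K) :
    Cell (permComplex K) p :=
  ⟨face U, ⟨n, U, hU, rfl⟩, by have := U.finrank_face_add; omega⟩

/-- The `p`-cells of the permutohedral complex correspond to the ordered partitions of the vertex
set into `m - p` simplices. -/
noncomputable def cellEquiv (K : AbstractSimplicialComplex (Fin m)) {p n : ℕ} (h : p + n = m) :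
    {U : OrderedPartition m n // U.IsIn K} ≃ Cell (permComplex K) p :=
  Equiv.ofBijective (fun U => cell h U.1 U.2) <| by
    constructor
    · intro U W hUW
      exact Subtype.ext (OrderedPartition.face_injective (congrArg Subtype.val hUW))
    · intro F
      obtain ⟨n', h', U, hU, hF⟩ := exists_orderedPartition_of_cell F
      obtain rfl : n = n' := by omega
      exact ⟨⟨U, hU⟩, Subtype.ext hF.symm⟩

theorem isEmpty_cell {p : ℕ} (h : m < p) : IsEmpty (Cell (permComplex K) p) := ⟨fun F => by
  obtain ⟨n, h', -⟩ := exists_orderedPartition_of_cell F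
  omega⟩

end Cells

end Permutohedral

/-! ## Orientations of the faces of the permutohedron -/

namespace Permutohedral

open Polytopal

namespace OrderedPartition

variable {m n p : ℕ}

/-- The indicator vector of a part. -/
noncomputable def partVec (U : OrderedPartition m n) (j : Fin n) : Fin m → ℝ :=
  fun a => if U.idx a = j then 1 else 0

/-- The `p` given vectors, followed by the indicator vectors of the parts. -/
noncomputable def orientRows (U : OrderedPartition m n) (h : p + n = m) (g : Fin p → Fin m → ℝ) :
    Fin m → Fin m → ℝ := fun i =>
  if hi : (i : ℕ) < p then g ⟨i, hi⟩ else U.partVec ⟨i - p, by omega⟩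

theorem orientRows_update (U : OrderedPartition m n) (h : p + n = m) (g : Fin p → Fin m → ℝ)
    (i : Fin p) (x : Fin m → ℝ) :
    U.orientRows h (Function.update g i x) =
      Function.update (U.orientRows h g) (i.castLE (by omega)) x := by
  funext l
  simp only [orientRows, Function.update_apply, Fin.ext_iff, Fin.val_castLE]
  split_ifs <;> first | rfl | (exfalso; omega)

/-- The alternating form that defines the orientation of the face of an ordered partition. -/
noncomputable def orientForm (U : OrderedPartition m n) (h : p + n = m) :
    (Fin m → ℝ) [⋀^Fin p]→ₗ[ℝ] ℝ where
  toFun g := (U.orientSign : ℝ) * Matrix.detRowAlternating (U.orientRows h g)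
  map_update_add' {inst} g i x y := by
    obtain rfl : inst = fun a b => instDecidableEqFin p a b := Subsingleton.elim _ _
    rw [orientRows_update, orientRows_update, orientRows_update, AlternatingMap.map_update_add,
      mul_add]
  map_update_smul' {inst} g i c x := by
    obtain rfl : inst = fun a b => instDecidableEqFin p a b := Subsingleton.elim _ _
    rw [orientRows_update, orientRows_update, AlternatingMap.map_update_smul, smul_eq_mul,
      smul_eq_mul, mul_left_comm]
  map_eq_zero_of_eq' g i j hij hne := by
    rw [AlternatingMap.map_eq_zero_of_eq _ (i := i.castLE (by omega)) (j := j.castLE (by omega)),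
      mul_zero]
    · simpa [orientRows] using hij
    · simpa [Fin.ext_iff] using hne

theorem orientForm_apply (U : OrderedPartition m n) (h : p + n = m) (g : Fin p → Fin m → ℝ) :
    U.orientForm h g = (U.orientSign : ℝ) * Matrix.det (Matrix.of (U.orientRows h g)) := rfl

theorem partSum_partVec (U : OrderedPartition m n) (j : Fin n) :
    U.partSum (U.partVec j) = Pi.single j ((U.part j).card : ℝ) := by
  funext i
  rw [partSum_apply]
  rcases eq_or_ne i j with rfl | hij
  · rw [Pi.single_eq_same, Finset.sum_congr rfl (g := fun _ => (1 : ℝ))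
      fun a ha => by rw [partVec, if_pos (U.mem_part.1 ha)]]
    simp
  · rw [Pi.single_eq_of_ne hij]
    exact Finset.sum_eq_zero fun a ha => if_neg fun h => hij ((U.mem_part.1 ha).symm.trans h)

theorem Splitting.idx_eq_predAbove {U : OrderedPartition m n} (s : U.Splitting) (a : Fin m) :
    U.idx a = s.1.predAbove (s.apply.idx a) := by
  rw [← idx_merge, s.merge_apply]

theorem partVec_eq_add {U : OrderedPartition m n} (s : U.Splitting) :
    U.partVec s.1 = s.apply.partVec s.1.castSucc + s.apply.partVec s.1.succ := by
  funext a
  have h2 := val_predAbove s.1 (s.apply.idx a)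
  simp only [Pi.add_apply, partVec, Fin.ext_iff, s.idx_eq_predAbove, Fin.val_castSucc, Fin.val_succ]
  split_ifs at * <;> first | (exfalso; omega) | simp

theorem orientSign_ne_zero (U : OrderedPartition m n) : (U.orientSign : ℝ) ≠ 0 := by
  have := U.orientSign_mul_self
  intro h
  rw [Int.cast_eq_zero] at h
  simp [h] at this

/-- In a linear relation among the rows, `partSum` kills the tangent vectors and isolates the
coefficient of each indicator vector, which must vanish; independence of `g` does the rest. -/
theorem orientForm_ne_zero (U : OrderedPartition m n) (h : p + n = m) {g : Fin p → Fin m → ℝ}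
    (hg : LinearIndependent ℝ g) (hU : ∀ i, g i ∈ LinearMap.ker U.partSum) :
    U.orientForm h g ≠ 0 := by
  rw [orientForm_apply]
  refine mul_ne_zero U.orientSign_ne_zero fun h0 => ?_
  obtain ⟨v, hv, h1⟩ := Matrix.exists_vecMul_eq_zero_iff.2 h0
  subst h
  have h2 : ∑ i : Fin p, v (i.castAdd n) • g i + ∑ j : Fin n, v (j.natAdd p) • U.partVec j = 0 := by
    have hl : ∀ i : Fin p, Matrix.of (U.orientRows rfl g) (i.castAdd n) = g i := fun i => by
      change U.orientRows rfl g _ = _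
      simp [orientRows]
    have hr : ∀ j : Fin n, Matrix.of (U.orientRows rfl g) (j.natAdd p) = U.partVec j := fun j => by
      change U.orientRows rfl g _ = _
      simp [orientRows]
    rw [Matrix.vecMul_eq_sum, Fin.sum_univ_add] at h1
    simpa only [hl, hr] using h1
  have h3 : ∀ j : Fin n, v (j.natAdd p) = 0 := by
    intro j
    have h4 := congrFun (congrArg U.partSum h2) j
    simp only [map_add, map_sum, map_smul, LinearMap.mem_ker.1 (hU _), partSum_partVec, smul_zero,
      Finset.sum_const_zero, zero_add, map_zero, Finset.sum_apply, Pi.smul_apply, Pi.zero_apply] at h4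
    rw [Finset.sum_eq_single j (fun i _ hij => by rw [Pi.single_eq_of_ne hij.symm, smul_zero])
      (fun h => absurd (Finset.mem_univ _) h), Pi.single_eq_same, smul_eq_mul] at h4
    exact (mul_eq_zero.1 h4).resolve_right (Nat.cast_ne_zero.2 (U.nonempty j).card_pos.ne')
  simp only [h3, zero_smul, Finset.sum_const_zero, add_zero] at h2
  have h5 := Fintype.linearIndependent_iff.1 hg _ h2
  refine hv (funext fun i => ?_)
  induction i using Fin.addCases with
  | left i => exact h5 i
  | right j => exact h3 j

theorem orientForm_eq_zero (U : OrderedPartition m n) (h : p + 1 + n = m)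
    (V : Submodule ℝ (Fin m → ℝ)) (hV : Module.finrank ℝ V = p) (g : Fin (p + 1) → Fin m → ℝ)
    (hg : ∀ i, g i ∈ V) : U.orientForm h g = 0 := by
  refine AlternatingMap.map_linearDependent _ _ fun hli => ?_
  have h1 : LinearIndependent ℝ fun i => (⟨g i, hg i⟩ : V) :=
    LinearIndependent.of_comp V.subtype hli
  have := h1.fintype_card_le_finrank
  rw [hV, Fintype.card_fin] at this
  omega

/-- The indicator vector of `M` in front can be moved to its place among those of the parts. -/
theorem det_orientRows_cons (U : OrderedPartition m n) (h : p + 1 + n = m) (s : U.Splitting)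
    (h' : p + (n + 1) = m) (g : Fin p → Fin m → ℝ) :
    Matrix.det (Matrix.of (U.orientRows h (Fin.cons (s.apply.partVec s.1.castSucc) g : Fin (p + 1) → Fin m → ℝ))) =
      (-1) ^ (p + s.1 : ℕ) * Matrix.det (Matrix.of (s.apply.orientRows h' g)) := by
  obtain ⟨U', hU'⟩ : ∃ W, W = s.apply := ⟨_, rfl⟩
  rw [← hU']
  have hs := s.1.2
  let R := U.orientRows h (Fin.cons (U'.partVec s.1.castSucc) g : Fin (p + 1) → Fin m → ℝ)
  let q : Fin m := ⟨p + 1 + s.1, by omega⟩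
  let q' : Fin m := ⟨p + s.1, by omega⟩
  have hm : 0 < m := by omega
  have hpart : U.partVec s.1 = U'.partVec s.1.castSucc + U'.partVec s.1.succ := by
    rw [hU', partVec_eq_add]
  have hR0 : R ⟨0, hm⟩ = U'.partVec s.1.castSucc := by
    simp [R, orientRows]
  have hRq : R q = U.partVec s.1 := by
    simp only [R, orientRows, q]
    rw [dif_neg (by omega)]
    congr 1
    ext
    simp
  have h0q : (⟨0, hm⟩ : Fin m) ≠ q := by
    rw [ne_eq, Fin.ext_iff]
    simp only [q]
    omega
  -- Row `q` is the indicator of `U_j`, and row `0` that of `M`; subtracting the latter leaves the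
  -- indicator of `U_j \ M`.
  have hadd : Matrix.detRowAlternating R =
      Matrix.detRowAlternating (Function.update R q (U'.partVec s.1.succ)) := by
    conv_lhs => rw [← Function.update_eq_self q R, hRq, hpart, AlternatingMap.map_update_add]
    rw [AlternatingMap.map_eq_zero_of_eq _ (i := ⟨0, hm⟩) (j := q), zero_add]
    · rw [Function.update_self, Function.update_of_ne h0q, hR0]
    · exact h0q
  -- The cycle on the first `p + j + 1` rows moves the indicator of `M` from the top to place `p +
  -- j`, with sign `(-1) ^ (p + j)`.
  have hperm : U'.orientRows h' g = fun i =>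
      Function.update R q (U'.partVec s.1.succ) (q'.cycleRange i) := by
    funext i
    have hother : ∀ l : Fin n, ∀ l' : Fin (n + 1),
        ((l : ℕ) < s.1 ∧ (l' : ℕ) = l ∨ (s.1 : ℕ) < l ∧ (l' : ℕ) = l + 1) →
        U'.partVec l' = U.partVec l := by
      intro l l' hl
      funext a
      have h1 : U.idx a = s.1.predAbove (U'.idx a) := by
        rw [hU', s.idx_eq_predAbove]
      have h2 := val_predAbove s.1 (U'.idx a)
      simp only [partVec, Fin.ext_iff, h1]
      split_ifs at * <;> first | (exfalso; omega) | rfl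
    rcases lt_trichotomy i q' with hi | rfl | hi
    · have h1 := Fin.coe_cycleRange_of_lt hi
      have hi' : (i : ℕ) < p + s.1 := hi
      rw [Function.update_of_ne (by rw [ne_eq, Fin.ext_iff, h1]; simp only [q]; omega)]
      obtain ⟨i', hi''⟩ : ∃ i', i' = q'.cycleRange i := ⟨_, rfl⟩
      rw [← hi''] at h1 ⊢
      obtain ⟨i', hi3⟩ := i'
      dsimp only at h1
      subst h1
      simp only [R, orientRows]
      by_cases hip : (i : ℕ) < p
      · rw [dif_pos hip, dif_pos (by omega)]
        rfl
      · rw [dif_neg hip, dif_neg (by omega)]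
        exact hother _ _ (Or.inl ⟨by dsimp only; omega, by dsimp only; omega⟩)
    · have : q'.cycleRange q' = ⟨0, hm⟩ := by
        ext
        rw [Fin.coe_cycleRange_of_le le_rfl, if_pos rfl]
      rw [this, Function.update_of_ne h0q, hR0]
      simp only [orientRows, q']
      rw [dif_neg (by omega)]
      congr 1
      ext
      simp
    · rw [Fin.cycleRange_of_gt hi]
      have hi' : p + (s.1 : ℕ) < i := hi
      rcases eq_or_ne i q with rfl | hne
      · rw [Function.update_self]
        simp only [orientRows, q]
        rw [dif_neg (by omega)]
        congr 1
        ext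
        simp only [Fin.val_succ]
        omega
      · rw [Function.update_of_ne hne]
        have hne' : (i : ℕ) ≠ p + 1 + s.1 := fun h => hne (Fin.ext h)
        simp only [R, orientRows]
        rw [dif_neg (by omega), dif_neg (by omega)]
        exact hother _ _ (Or.inr ⟨by dsimp only; omega, by dsimp only; omega⟩)
  have hdet := Matrix.det_permute q'.cycleRange
    (Matrix.of (Function.update R q (U'.partVec s.1.succ)))
  change Matrix.detRowAlternating R = _
  rw [hadd, hperm]
  change _ = _ * Matrix.det ((Matrix.of (Function.update R q (U'.partVec s.1.succ))).submatrix
    q'.cycleRange id)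
  rw [hdet, Fin.sign_cycleRange, ← mul_assoc]
  have : ((((-1) ^ (q' : ℕ) : ℤˣ) : ℤ) : ℝ) = (-1) ^ (p + s.1 : ℕ) := by
    simp [q']
  rw [this, ← pow_add, Even.neg_one_pow (Even.add_self _), one_mul]
  rfl

/-- The relation between the forms of a face and of one of its facets. -/
theorem orientForm_cons (U : OrderedPartition m n) (h : p + 1 + n = m) (s : U.Splitting)
    (h' : p + (n + 1) = m) {v : Fin m → ℝ} (hv : v ∈ LinearMap.ker U.partSum)
    {g : Fin p → Fin m → ℝ} (hg : ∀ i, g i ∈ LinearMap.ker s.apply.partSum) :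
    U.orientForm h (Fin.cons v g : Fin (p + 1) → Fin m → ℝ) =
      -(∑ a ∈ s.2.1, v a) * ((1 : ℝ) / s.2.1.card + 1 / (U.part s.1 \ s.2.1).card) *
        milgramSign U s.1 s.2.1 * s.apply.orientForm h' g := by
  have hM : s.apply.part s.1.castSucc = s.2.1 := part_split_castSucc _ _ _ _ _
  have hN : s.apply.part s.1.succ = U.part s.1 \ s.2.1 := part_split_succ _ _ _ _ _
  have hMpos : (0 : ℝ) < s.2.1.card := Nat.cast_pos.2 s.2.2.1.card_pos
  have hNpos : (0 : ℝ) < (U.part s.1 \ s.2.1).card :=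
    Nat.cast_pos.2 (by rw [← hN]; exact (s.apply.nonempty _).card_pos)
  set μ := ∑ a ∈ s.2.1, v a with hμ
  set cM : ℝ := (s.2.1.card : ℝ)
  set cN : ℝ := ((U.part s.1 \ s.2.1).card : ℝ)
  -- the form as a function of the first vector
  let D : (Fin m → ℝ) →ₗ[ℝ] ℝ :=
    { toFun := fun x => U.orientForm h (Fin.cons x g : Fin (p + 1) → Fin m → ℝ)
      map_add' := fun x y => (U.orientForm h).toMultilinearMap.cons_add g x y
      map_smul' := fun c x => (U.orientForm h).toMultilinearMap.cons_smul g c x }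
  -- The indicator of `U_j` already occurs among the later rows.
  have hDU : D (U.partVec s.1) = 0 := by
    have hs := s.1.2
    change (U.orientSign : ℝ) * Matrix.detRowAlternating (U.orientRows h _) = 0
    rw [AlternatingMap.map_eq_zero_of_eq _ (i := ⟨0, by omega⟩)
      (j := ⟨p + 1 + s.1, by omega⟩), mul_zero]
    · simp only [orientRows]
      rw [dif_pos (by omega), dif_neg (by omega)]
      change U.partVec s.1 = _
      congr 1
      ext
      simp
    · rw [ne_eq, Fin.ext_iff]
      dsimp only
      omega
  have hDN : D (s.apply.partVec s.1.succ) = -D (s.apply.partVec s.1.castSucc) := by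
    rw [partVec_eq_add, map_add] at hDU
    linarith
  have hDM : D (s.apply.partVec s.1.castSucc) =
      -((milgramSign U s.1 s.2.1 : ℤ) : ℝ) * s.apply.orientForm h' g := by
    change U.orientForm h _ = _
    rw [orientForm_apply, det_orientRows_cons U h s h', orientForm_apply, ← orientSign_splitting h]
    have := congrArg (Int.cast : ℤ → ℝ) s.apply.orientSign_mul_self
    push_cast at this ⊢
    rw [pow_succ]
    linear_combination (-(U.orientSign : ℝ) * (-1) ^ (p + s.1 : ℕ) *
      (Matrix.of (s.apply.orientRows h' g)).det) * this
  -- decompose the first vector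
  have hdec : D (v - (μ / cM) • s.apply.partVec s.1.castSucc +
      (μ / cN) • s.apply.partVec s.1.succ) = 0 := by
    -- The sums of `v` over `M` and `U_j \ M` are `μ` and `-μ`; after the correction both vanish. So
    -- all `p + 1` vectors lie in the `p`-dimensional direction space of the facet.
    refine U.orientForm_eq_zero h (LinearMap.ker s.apply.partSum) ?_ _ fun i => ?_
    · have := s.apply.finrank_face_add
      rw [vectorSpan_face] at this
      omega
    · induction i using Fin.cases with
      | succ i => exact hg i
      | zero =>
        rw [Fin.cons_zero, LinearMap.mem_ker, map_add, map_sub, map_smul, map_smul,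
          partSum_partVec, partSum_partVec]
        have hUv : ∀ j, ∑ a ∈ U.part j, v a = 0 := fun j => by
          rw [← partSum_apply, LinearMap.mem_ker.1 hv]; rfl
        have hMv : s.apply.partSum v s.1.castSucc = μ := by rw [partSum_apply, hM]
        have hNv : s.apply.partSum v s.1.succ = -μ := by
          rw [partSum_apply, hN]
          have := Finset.sum_sdiff (f := v) s.2.2.2.1
          rw [hUv] at this
          linarith
        funext l
        simp only [Pi.add_apply, Pi.sub_apply, Pi.smul_apply, smul_eq_mul, Pi.zero_apply]
        have hne : s.1.castSucc ≠ s.1.succ := by simp [Fin.ext_iff]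
        rcases eq_or_ne l s.1.castSucc with rfl | hl1
        · rw [hMv, Pi.single_eq_same, Pi.single_eq_of_ne hne, hM]
          field_simp
          ring
        rcases eq_or_ne l s.1.succ with rfl | hl2
        · rw [hNv, Pi.single_eq_same, Pi.single_eq_of_ne hne.symm, hN]
          field_simp
          ring
        · rw [Pi.single_eq_of_ne hl1, Pi.single_eq_of_ne hl2, mul_zero, mul_zero, sub_zero,
            add_zero, partSum_apply]
          have h3 : s.apply.part l = U.part (s.1.predAbove l) := by
            ext a
            have h1 := s.idx_eq_predAbove a
            have h2 := val_predAbove s.1 (s.apply.idx a)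
            have h3 := val_predAbove s.1 l
            simp only [ne_eq, Fin.ext_iff, Fin.val_castSucc, Fin.val_succ] at hl1 hl2
            rw [mem_part, mem_part, h1, Fin.ext_iff, Fin.ext_iff]
            split_ifs at h2 h3 <;> omega
          rw [h3, hUv]
  rw [map_add, map_sub, map_smul, map_smul, hDN, hDM, smul_eq_mul, smul_eq_mul] at hdec
  change D v = _
  have : D v = μ / cM * (-((milgramSign U s.1 s.2.1 : ℤ) : ℝ) * s.apply.orientForm h' g) +
    μ / cN * (-((milgramSign U s.1 s.2.1 : ℤ) : ℝ) * s.apply.orientForm h' g) := by linarith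
  rw [this]
  ring

/-- For singleton parts the matrix is a permutation matrix. Its sign is given by the inversions in
`orientSign`, and the two index sums there cancel modulo two; this makes vertices positive. -/
theorem orientForm_vertex (U : OrderedPartition m n) (h : 0 + n = m) (g : Fin 0 → Fin m → ℝ) :
    U.orientForm h g = 1 := by
  obtain rfl : n = m := by omega
  let π : Equiv.Perm (Fin n) := Equiv.ofBijective U.idx
    ⟨Finite.injective_iff_surjective.2 U.idx_surjective, U.idx_surjective⟩
  have hdet : Matrix.of (U.orientRows h g) = (1 : Matrix (Fin n) (Fin n) ℝ).submatrix id π := by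
    ext i a
    simp only [Matrix.of_apply, orientRows, Matrix.submatrix_apply, Matrix.one_apply]
    rw [dif_neg (by omega)]
    have h1 : π a = U.idx a := rfl
    simp only [id, partVec, h1, Nat.sub_zero, Fin.eta]
    exact if_congr eq_comm rfl rfl
  have hsum : ∑ a, (U.idx a : ℕ) = ∑ i : Fin n, (i : ℕ) := Equiv.sum_comp π fun i : Fin n => (i : ℕ)
  have hsign : ((Equiv.Perm.sign π : ℤˣ) : ℤ) = (-1) ^ (Finset.univ.filter fun q : Fin n × Fin n =>
      q.1 < q.2 ∧ U.idx q.2 < U.idx q.1).card := by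
    rw [Equiv.Perm.sign_eq_prod_prod_Ioi, Units.coe_prod]
    rw [← Finset.prod_const, Finset.prod_filter, Fintype.prod_prod_type]
    refine Finset.prod_congr rfl fun i _ => ?_
    rw [Units.coe_prod]
    have : Finset.Ioi i = Finset.univ.filter (i < ·) := by ext; simp
    rw [this, Finset.prod_filter]
    refine Finset.prod_congr rfl fun j _ => ?_
    have hπ : ∀ a, π a = U.idx a := fun _ => rfl
    by_cases hij : i < j
    · have hne : U.idx i ≠ U.idx j := fun h => hij.ne (π.injective h)
      rcases lt_or_gt_of_ne hne with h1 | h1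
      · simp [hij, hπ, h1, h1.not_gt]
      · simp [hij, hπ, h1, h1.not_gt]
    · simp [hij]
  rw [orientForm_apply, hdet, Matrix.det_permute', Matrix.det_one, mul_one, hsign, ← Int.cast_mul,
    orientSign, hsum, ← pow_add, Even.neg_one_pow, Int.cast_one]
  rw [Nat.even_iff]
  omega

end OrderedPartition

end Permutohedral

/-! ## The incidence numbers of the permutohedral complex -/

namespace Permutohedral

open Polytopal

variable {m : ℕ} {K : AbstractSimplicialComplex (Fin m)}

/-- The alternating form that defines the orientation of a cell. -/
noncomputable def cellForm {p : ℕ} (F : Cell (permComplex K) p) :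
    (vectorSpan ℝ F.1) [⋀^Fin p]→ₗ[ℝ] ℝ :=
  ((exists_orderedPartition_of_cell F).choose_spec.choose_spec.choose.orientForm
    (exists_orderedPartition_of_cell F).choose_spec.choose).compLinearMap (vectorSpan ℝ F.1).subtype

/-- The partition chosen in `cellForm` does not matter: its number of parts is fixed by `p`, and the
face then determines it. -/
theorem cellForm_apply {p n : ℕ} (F : Cell (permComplex K) p) (h : p + n = m)
    {U : OrderedPartition m n} (hF : F.1 = face U) (g : Fin p → vectorSpan ℝ F.1) :
    cellForm F g = U.orientForm h fun i => (g i : Fin m → ℝ) := by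
  have key : ∀ {n' : ℕ} (h' : p + n' = m) (W : OrderedPartition m n'), F.1 = face W →
      W.orientForm h' (fun i => (g i : Fin m → ℝ)) = U.orientForm h fun i => (g i : Fin m → ℝ) := by
    intro n' h' W hW
    obtain rfl : n = n' := by omega
    rw [OrderedPartition.face_injective (hW.symm.trans hF)]
  exact key _ _ (exists_orderedPartition_of_cell F).choose_spec.choose_spec.choose_spec.2

theorem cellForm_ne_zero_of_linearIndependent {p : ℕ} (F : Cell (permComplex K) p)
    {g : Fin p → vectorSpan ℝ F.1} (hg : LinearIndependent ℝ g) : cellForm F g ≠ 0 := by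
  obtain ⟨n, h, U, hU, hF⟩ := exists_orderedPartition_of_cell F
  rw [cellForm_apply F h hF]
  refine U.orientForm_ne_zero h (hg.map' (vectorSpan ℝ F.1).subtype (Submodule.ker_subtype _))
    fun i => ?_
  rw [← U.vectorSpan_face, ← hF]
  exact (g i).2

theorem cellForm_ne_zero {p : ℕ} (F : Cell (permComplex K) p) : cellForm F ≠ 0 := fun h =>
  cellForm_ne_zero_of_linearIndependent F
    (Module.finBasisOfFinrankEq ℝ (vectorSpan ℝ F.1) F.2.2).linearIndependent (by rw [h]; rfl)

/-- The orientations of the cells of the permutohedral complex. -/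
noncomputable def permOrientation (K : AbstractSimplicialComplex (Fin m)) :
    CellOrientation (permComplex K) where
  orient p F := rayOfNeZero ℝ (cellForm F) (cellForm_ne_zero F)
  orient_vertex F := by
    obtain ⟨n, h, U, hU, hF⟩ := exists_orderedPartition_of_cell F
    rw [positiveOrientation]
    congr 1
    ext g
    rw [cellForm_apply F h hF, U.orientForm_vertex]
    rfl

theorem orientation_eq_iff {p : ℕ} (F : Cell (permComplex K) p)
    (b : Module.Basis (Fin p) ℝ (vectorSpan ℝ F.1)) :
    b.orientation = (permOrientation K).orient p F ↔ 0 < cellForm F b := by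
  rw [Module.Basis.orientation, permOrientation, ray_eq_iff, (cellForm F).eq_smul_basis_det b,
    sameRay_smul_right_iff_of_ne b.det_ne_zero
      (cellForm_ne_zero_of_linearIndependent F b.linearIndependent)]
  rw [← (cellForm F).eq_smul_basis_det b]

theorem exists_basis_orientation {p : ℕ} (F : Cell (permComplex K) p) :
    ∃ b : Module.Basis (Fin p) ℝ (vectorSpan ℝ F.1),
      b.orientation = (permOrientation K).orient p F := by
  let b := Module.finBasisOfFinrankEq ℝ (vectorSpan ℝ F.1) F.2.2
  -- A basis indexed by the empty type cannot be adjusted, so in dimension zero the convention for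
  -- vertices is what makes this true.
  rcases p with _ | p
  · exact ⟨b, by rw [b.orientation_isEmpty, (permOrientation K).orient_vertex]⟩
  · exact ⟨b.adjustToOrientation _, b.orientation_adjustToOrientation _⟩

theorem milgramSign_eq_or {n : ℕ} (U : OrderedPartition m n) (j : Fin n) (M : Finset (Fin m)) :
    milgramSign U j M = 1 ∨ milgramSign U j M = -1 := by
  rw [milgramSign, shuff, ← pow_add]
  exact neg_one_pow_eq_or ℤ _

/-- The forms of a cell and of one of its facets, on an outward pointing vector and vectors
parallel to the facet. -/
theorem cellForm_cons {p n : ℕ} {F : Cell (permComplex K) (p + 1)} {G : Cell (permComplex K) p}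
    (h : p + 1 + n = m) {U : OrderedPartition m n} (hF : F.1 = face U) (s : U.Splitting)
    (hG : G.1 = face s.apply) (bF : Fin (p + 1) → vectorSpan ℝ F.1)
    (bG : Fin p → vectorSpan ℝ G.1) (hb : ∀ i, (bF i.succ : Fin m → ℝ) = bG i) :
    ∃ c : ℝ, 0 < c ∧ cellForm F bF =
      -(∑ a ∈ s.2.1, (bF 0 : Fin m → ℝ) a) * c * milgramSign U s.1 s.2.1 * cellForm G bG := by
  have h' : p + (n + 1) = m := by omega
  refine ⟨(1 : ℝ) / s.2.1.card + 1 / (U.part s.1 \ s.2.1).card, ?_, ?_⟩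
  · have hM : (0 : ℝ) < s.2.1.card := Nat.cast_pos.2 s.2.2.1.card_pos
    positivity
  · rw [cellForm_apply F h hF, cellForm_apply G h' hG]
    have hcons : (fun i => (bF i : Fin m → ℝ)) =
        (Fin.cons (bF 0 : Fin m → ℝ) fun i => (bG i : Fin m → ℝ) : Fin (p + 1) → Fin m → ℝ) := by
      funext i
      induction i using Fin.cases with
      | zero => rfl
      | succ i => exact hb i
    rw [hcons, U.orientForm_cons h s h']
    · rw [← U.vectorSpan_face, ← hF]
      exact (bF 0).2
    · intro i
      rw [← s.apply.vectorSpan_face, ← hG]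
      exact (bG i).2

/-- On an outward vector followed by a positive basis of the facet, the form of `F` is the Milgram
sign times a nonnegative number. The weak inequality suffices, because the form does not vanish on a
basis. -/
theorem incidence_splitting {p n : ℕ} {F : Cell (permComplex K) (p + 1)}
    {G : Cell (permComplex K) p} (h : p + 1 + n = m) {U : OrderedPartition m n}
    (hF : F.1 = face U) (s : U.Splitting) (hG : G.1 = face s.apply) :
    incidence (permOrientation K) F G = milgramSign U s.1 s.2.1 := by
  have hsub : G.1 ⊆ F.1 := by
    rw [hF, hG, OrderedPartition.face_subset_face_iff]
    exact fun a b => OrderedPartition.idx_split_lt s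
  have hind : IsInduced (permOrientation K) F G ↔ milgramSign U s.1 s.2.1 = 1 := by
    constructor
    · rintro ⟨bF, bG, hbF, hbG, ⟨x, hx, y, hy, hxy⟩, hb⟩
      rw [orientation_eq_iff] at hbF hbG
      obtain ⟨c, hc, heq⟩ := cellForm_cons h hF s hG bF bG hb
      have hle : ∑ a ∈ s.2.1, (bF 0 : Fin m → ℝ) a ≤ 0 := by
        simp only [hxy, Pi.sub_apply, Finset.sum_sub_distrib, sub_nonpos]
        exact OrderedPartition.sum_le_sum_of_mem_face s (hG ▸ hx) (hF ▸ hy)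
      refine (milgramSign_eq_or U s.1 s.2.1).resolve_right fun hneg => ?_
      rw [hneg] at heq
      have : 0 ≤ -(∑ a ∈ s.2.1, (bF 0 : Fin m → ℝ) a) * c * cellForm G bG :=
        mul_nonneg (mul_nonneg (neg_nonneg.2 hle) hc.le) hbG.le
      push_cast at heq
      linarith
    · intro hone
      obtain ⟨bG, hbG⟩ := exists_basis_orientation G
      obtain ⟨σ, hσ⟩ := s.apply.exists_compat
      have hσU : U.Compat σ := fun a b hab => hσ a b (OrderedPartition.idx_split_lt s hab)
      obtain ⟨a, ha⟩ := s.2.2.1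
      obtain ⟨b, hb⟩ := Finset.sdiff_nonempty.2 s.2.2.2.2
      rw [Finset.mem_sdiff] at hb
      have hab : U.idx a = U.idx b := by
        rw [U.mem_part.1 hb.1, U.mem_part.1 (s.2.2.2.1 ha)]
      have hlt : σ a < σ b := by
        refine hσ a b ?_
        have e1 := s.apply.mem_part.1
          ((OrderedPartition.part_split_castSucc U s.1 s.2.1 s.2.2.1 s.2.2.2).symm ▸ ha)
        have e2 := s.apply.mem_part.1
          ((OrderedPartition.part_split_succ U s.1 s.2.1 s.2.2.1 s.2.2.2).symm ▸
            Finset.mem_sdiff.2 hb)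
        rw [e1, e2]
        simp [Fin.lt_def]
      -- An explicit outward vector: from a vertex of the facet, subtract the vertex with the values
      -- at `a ∈ M` and `b ∈ U_j \ M` exchanged. Its sum over `M` is `σ a - σ b < 0`.
      let v : vectorSpan ℝ F.1 := ⟨vertex σ - vertex (σ * Equiv.swap a b), by
        rw [hF]
        exact vsub_mem_vectorSpan ℝ hσU.vertex_mem (hσU.mul_swap hab).vertex_mem⟩
      have hle : vectorSpan ℝ G.1 ≤ vectorSpan ℝ F.1 := vectorSpan_mono ℝ hsub
      let g : Fin (p + 1) → vectorSpan ℝ F.1 := Fin.cons v fun i => Submodule.inclusion hle (bG i)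
      obtain ⟨c, hc, heq⟩ := cellForm_cons h hF s hG g bG fun i => rfl
      have hsum : ∑ l ∈ s.2.1, (g 0 : Fin m → ℝ) l = ((σ a : ℕ) : ℝ) - ((σ b : ℕ) : ℝ) := by
        change ∑ l ∈ s.2.1, (vertex σ - vertex (σ * Equiv.swap a b)) l = _
        rw [OrderedPartition.vertex_sub_vertex_swap]
        simp only [Pi.smul_apply, Pi.sub_apply, smul_eq_mul, ← Finset.mul_sum,
          Finset.sum_sub_distrib, Pi.single_apply, Finset.sum_ite_eq', ha, hb.2, if_true, if_false]
        ring
      have hpos : 0 < cellForm F g := by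
        rw [heq, hone, hsum, Int.cast_one, mul_one]
        refine mul_pos (mul_pos ?_ hc) ((orientation_eq_iff G bG).1 hbG)
        rw [neg_pos, sub_neg, Nat.cast_lt]
        exact hlt
      have hli : LinearIndependent ℝ g := by
        by_contra hli
        exact hpos.ne' ((cellForm F).map_linearDependent g hli)
      let bF := basisOfLinearIndependentOfCardEqFinrank hli (by rw [F.2.2, Fintype.card_fin])
      have hbF : ⇑bF = g := coe_basisOfLinearIndependentOfCardEqFinrank _ _
      refine ⟨bF, bG, ?_, hbG, ⟨vertex σ, hG ▸ hσ.vertex_mem, vertex (σ * Equiv.swap a b),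
        hF ▸ (hσU.mul_swap hab).vertex_mem, ?_⟩, fun i => ?_⟩
      · rw [orientation_eq_iff, hbF]
        exact hpos
      · rw [hbF]; rfl
      · rw [hbF]; rfl
  rw [incidence, if_pos hsub]
  split_ifs with hi
  · exact (hind.1 hi).symm
  · exact ((milgramSign_eq_or U s.1 s.2.1).resolve_left fun h1 => hi (hind.2 h1)).symm

/-- The cellular boundary of the face of an ordered partition. -/
theorem boundary_single {p n : ℕ} (h : p + 1 + n = m) (h' : p + (n + 1) = m)
    (U : OrderedPartition m n) (hU : U.IsIn K) {F : Cell (permComplex K) (p + 1)}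
    (hF : F.1 = face U) :
    boundary (permOrientation K) p (Finsupp.single F 1) =
      ∑ s : U.Splitting, Finsupp.single (cell h' s.apply (hU.splitting s))
        (milgramSign U s.1 s.2.1) := by
  have hinj : Function.Injective fun s : U.Splitting => cell h' s.apply (hU.splitting s) :=
    fun s t hst => OrderedPartition.Splitting.apply_injective U
      (OrderedPartition.face_injective (congrArg Subtype.val hst))
  rw [boundary, Finsupp.linearCombination_single, one_smul]
  have hinc : ∀ s : U.Splitting,
      Finsupp.single (cell h' s.apply (hU.splitting s)) (milgramSign U s.1 s.2.1) =
        Finsupp.single (cell h' s.apply (hU.splitting s))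
          (incidence (permOrientation K) F (cell h' s.apply (hU.splitting s))) := fun s => by
    rw [incidence_splitting h hF s rfl]
  rw [Finset.sum_congr rfl fun s _ => hinc s, ← finsum_eq_sum_of_fintype,
    ← finsum_mem_range (f := fun G => Finsupp.single G (incidence (permOrientation K) F G)) hinj,
    ← finsum_mem_univ]
  -- A cell with nonzero incidence number lies in `F`, so its partition refines `U` with one more
  -- part and is a splitting.
  refine finsum_mem_inter_support_eq' _ _ _ fun G hG => ⟨fun _ => ?_, fun _ => Set.mem_univ _⟩
  have hsub : G.1 ⊆ F.1 := by
    by_contra hsub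
    exact hG (by simp [incidence, hsub])
  obtain ⟨⟨W, hW⟩, hWG⟩ := (cellEquiv K h').surjective G
  have hWG' : G.1 = face W := congrArg Subtype.val hWG.symm
  rw [hF, hWG', OrderedPartition.face_subset_face_iff] at hsub
  obtain ⟨s, rfl⟩ := OrderedPartition.exists_splitting hsub
  exact ⟨s, hWG⟩

theorem mapDomain_boundary_single {p n : ℕ} (U : OrderedPartition m n) (hU : U.IsIn K)
    (F : Cell (permComplex K) (p + 1)) (hF : F.1 = face U) :
    Finsupp.mapDomain Subtype.val (boundary (permOrientation K) p (Finsupp.single F 1)) =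
      milgramBoundary U := by
  have h : p + 1 + n = m := by
    rw [← F.2.2, hF]
    exact U.finrank_face_add
  rw [boundary_single h (by omega) U hU hF, Finsupp.mapDomain_finsetSum, milgramBoundary,
    Fintype.sum_sigma]
  simp only [Finsupp.mapDomain_single]
  rfl

end Permutohedral

/-! ## The isomorphism with the bar construction -/

namespace Permutohedral

open Polytopal BarConstruction StanleyReisner

variable (k : Type*) [CommRing k] {m : ℕ} (K : AbstractSimplicialComplex (Fin m))

/-- The isomorphism of the cellular cochains with a component of the bar construction. -/
noncomputable def cochainEquiv {p n : ℕ} (h : p + n = m) :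
    Cochain (permComplex K) k p ≃ₗ[k] barComponent k K n 1 :=
  (Finsupp.llift k ℤ k (Cell (permComplex K) p)).symm ≪≫ₗ
    LinearEquiv.funCongrLeft k k (cellEquiv K h) ≪≫ₗ barEquiv k K n

variable {k K}

open scoped Classical in
/-- The value of a cochain at the cell of an ordered partition. -/
noncomputable def evalCell {p n : ℕ} (h : p + n = m) (c : Cochain (permComplex K) k p)
    (U : OrderedPartition m n) : k :=
  if hU : U.IsIn K then c (Finsupp.single (cell h U hU) 1) else 0

/-- The sum may run over all ordered partitions, since bar monomials with a part outside `K` vanish.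
This is needed for reindexing, because merging can leave `K`. -/
theorem coe_cochainEquiv {p n : ℕ} (h : p + n = m) (c : Cochain (permComplex K) k p) :
    (cochainEquiv k K h c : Bar (gr k K) n) =
      ∑ U : OrderedPartition m n, evalCell h c U • barMonomial k K U.part U.nonempty := by
  classical
  change ((barEquiv k K n (fun U => c (Finsupp.single (cellEquiv K h U) 1)) :
    barComponent k K n 1) : Bar (gr k K) n) = _
  rw [coe_barEquiv]
  refine Fintype.sum_of_injective Subtype.val Subtype.val_injective _ _ (fun U hU => ?_) fun U => ?_
  · rw [barMonomial_eq_zero k K U fun hU' => hU ⟨⟨U, hU'⟩, rfl⟩, smul_zero]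
  · rw [evalCell, dif_pos U.2]
    rfl

theorem cochainEquiv_dualCochain {p n : ℕ} (h : p + n = m) {U : OrderedPartition m n}
    (hU : U.IsIn K) :
    (cochainEquiv k K h (dualCochain k (cell h U hU)) : Bar (gr k K) n) =
      barMonomial k K U.part U.nonempty := by
  rw [coe_cochainEquiv, Finset.sum_eq_single U]
  · rw [evalCell, dif_pos hU, dualCochain, Finsupp.linearCombination_single, if_pos rfl, one_smul,
      one_smul]
  · intro W _ hWU
    by_cases hW : W.IsIn K
    · rw [evalCell, dif_pos hW, dualCochain, Finsupp.linearCombination_single, if_neg, smul_zero,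
        zero_smul]
      exact fun h' => hWU (OrderedPartition.face_injective (congrArg Subtype.val h'))
    · rw [evalCell, dif_neg hW, zero_smul]
  · exact fun h' => absurd (Finset.mem_univ _) h'

theorem evalCell_coboundary {p n : ℕ} (h : p + 1 + n = m) (h' : p + (n + 1) = m)
    (c : Cochain (permComplex K) k p) {U : OrderedPartition m n} (hU : U.IsIn K) :
    evalCell h (coboundary k (permOrientation K) p c) U =
      ∑ s : U.Splitting, ((milgramSign U s.1 s.2.1 : ℤ) : k) * evalCell h' c s.apply := by
  rw [evalCell, dif_pos hU]
  change c (boundary (permOrientation K) p _) = _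
  rw [boundary_single h h' U hU rfl, map_sum]
  refine Finset.sum_congr rfl fun s _ => ?_
  rw [evalCell, dif_pos (hU.splitting s), ← zsmul_eq_mul, ← map_zsmul, Finsupp.smul_single,
    smul_eq_mul, mul_one]

theorem cochainEquiv_coboundary {p n : ℕ} (h : p + 1 + n = m) (h' : p + (n + 1) = m)
    (c : Cochain (permComplex K) k p) :
    (cochainEquiv k K h (coboundary k (permOrientation K) p c) : Bar (gr k K) n) =
      barDiff (gr k K) n (cochainEquiv k K h' c) := by
  have h1 : ∀ U : OrderedPartition m n,
      evalCell h (coboundary k (permOrientation K) p c) U • barMonomial k K U.part U.nonempty =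
        ∑ s : U.Splitting, (((milgramSign U s.1 s.2.1 : ℤ) : k) * evalCell h' c s.apply) •
          barMonomial k K U.part U.nonempty := by
    intro U
    by_cases hU : U.IsIn K
    · rw [evalCell_coboundary h h' c hU, Finset.sum_smul]
    · simp only [barMonomial_eq_zero k K U hU, smul_zero, Finset.sum_const_zero]
  have h2 : ∀ W : OrderedPartition m (n + 1),
      barDiff (gr k K) n (evalCell h' c W • barMonomial k K W.part W.nonempty) =
        ∑ i : Fin n,
          (((milgramSign (W.merge i) i (W.part i.castSucc) : ℤ) : k) * evalCell h' c W) •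
            barMonomial k K (W.merge i).part (W.merge i).nonempty := by
    intro W
    rw [map_smul, barDiff_barMonomial, Finset.smul_sum]
    exact Finset.sum_congr rfl fun i _ => by rw [smul_smul, mul_comm]
  rw [coe_cochainEquiv, coe_cochainEquiv, map_sum, Finset.sum_congr rfl fun U _ => h1 U,
    Finset.sum_congr rfl fun W _ => h2 W, ← Fintype.sum_sigma', ← Fintype.sum_prod_type']
  -- Pairs of a partition and a splitting become pairs of a finer partition and a place to merge;
  -- the two double sums then agree term by term.
  refine Fintype.sum_equiv (OrderedPartition.splitEquiv m n) _ _ ?_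
  rintro ⟨U, s⟩
  have h3 : OrderedPartition.splitEquiv m n ⟨U, s⟩ = (s.apply, s.1) := rfl
  have h4 : s.apply.part s.1.castSucc = s.2.1 :=
    OrderedPartition.part_split_castSucc U s.1 s.2.1 s.2.2.1 s.2.2.2
  rw [h3]
  dsimp only
  rw [s.merge_apply, h4]

theorem subsingleton_cochain {p : ℕ} (h : m < p) : Subsingleton (Cochain (permComplex K) k p) := by
  have := isEmpty_cell (K := K) h
  exact ⟨fun c c' => LinearMap.ext fun x => by rw [Subsingleton.elim x 0, map_zero, map_zero]⟩

/-- Transported from the bar construction through the injective cochain maps; above degree `m` the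
target is trivial. -/
theorem coboundary_comp_coboundary (p : ℕ) :
    coboundary k (permOrientation K) (p + 1) ∘ₗ coboundary k (permOrientation K) p = 0 := by
  refine LinearMap.ext fun c => ?_
  rcases lt_or_ge m (p + 1 + 1) with h | h
  · have := subsingleton_cochain (k := k) (K := K) h
    exact Subsingleton.elim _ _
  · obtain ⟨n, hn⟩ := Nat.exists_eq_add_of_le h
    have h2 : p + 1 + 1 + n = m := hn.symm
    refine (cochainEquiv k K h2).injective (Subtype.ext ?_)
    rw [LinearMap.comp_apply, LinearMap.zero_apply, map_zero,
      cochainEquiv_coboundary h2 (by omega), cochainEquiv_coboundary (by omega) (by omega)]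
    exact LinearMap.congr_fun (barDiff_comp_barDiff (gr k K) n) _

end Permutohedral

theorem mainTheorem4 (k : Type*) [CommRing k] (m : ℕ) (K : AbstractSimplicialComplex (Fin m)) :
    ∃ o : CellOrientation (permComplex K),
      -- the cellular boundary is given by Milgram's formula
      (∀ (n p : ℕ) (U : OrderedPartition m n), U.IsIn K →
        ∀ F : Cell (permComplex K) (p + 1), F.1 = face U →
          Finsupp.mapDomain Subtype.val (boundary o p (Finsupp.single F 1)) =
            milgramBoundary U) ∧
      -- both sides are complexes, and the component is a subcomplex
      (∀ p, coboundary k o (p + 1) ∘ₗ coboundary k o p = 0) ∧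
      (∀ n, barDiff (gr k K) n ∘ₗ barDiff (gr k K) (n + 1) = 0) ∧
      (∀ n, ∀ t ∈ barComponent k K (n + 1) 1, barDiff (gr k K) n t ∈ barComponent k K n 1) ∧
      -- both sides vanish outside the degrees `0 ≤ p ≤ m`
      (∀ p, m < p → Subsingleton (Cochain (permComplex K) k p)) ∧
      (∀ n, m < n → barComponent k K n 1 = ⊥) ∧
      -- the isomorphism `C^p(Perm(K); k) ≅ B̄^{p-m}(Λ[K])_{(1,…,1)}`, where `p - m = -n`
      ∃ φ : ∀ p n : ℕ, p + n = m → (Cochain (permComplex K) k p ≃ₗ[k] barComponent k K n 1),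
        (∀ (p n : ℕ) (h : p + n = m) (U : OrderedPartition m n), U.IsIn K →
          ∃ F : Cell (permComplex K) p, F.1 = face U ∧
            (φ p n h (dualCochain k F) : Bar (gr k K) n) = barMonomial k K U.part U.nonempty) ∧
        (∀ (p n : ℕ) (h : p + (n + 1) = m) (c : Cochain (permComplex K) k p),
          (φ (p + 1) n (by omega) (coboundary k o p c) : Bar (gr k K) n) =
            barDiff (gr k K) n (φ p (n + 1) h c)) :=
  ⟨permOrientation K, fun _ _ U hU F hF => mapDomain_boundary_single U hU F hF,
    coboundary_comp_coboundary, barDiff_comp_barDiff (gr k K),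
    fun n _ ht => barDiff_mem_barComponent k K n ht, fun _ h => subsingleton_cochain h,
    fun _ h => barComponent_eq_bot k K h, fun _ _ h => cochainEquiv k K h,
    fun _ _ h U hU => ⟨cell h U hU, rfl, cochainEquiv_dualCochain h hU⟩,
    fun _ _ h c => cochainEquiv_coboundary (by omega) h c⟩
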